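/- **Definitions.** A *polygon* is a finite CW complex homeomorphic to a closed disk, with exactly one 2-cell and at least three 0-cells (vertices). A *polygonal subdivision* $\mathcal R(P)$ of a polygon $P$ is a subdivision of $P$ into $m\ge 2$ closed 2-cells $P_1,\dots,P_m$, where each $P_j$ is a polygon with $n_j$ vertices, and no edge of $\partial P$ contains a vertex of $\mathcal R(P)$ in its interior. Let $\mathcal G$ be its 1-skeleton, with vertex set $\mathcal V$. The pair $(\mathcal G,\partial P)$ is a *polygonal subdivision graph*; it is *simple* if $\mathcal G$ has no loops and no multiple edges. Its *subdivision complexity* is $\max\{n_1,\dots,n_m\}$. (For simple $\mathcal G$, such a subdivision amounts to a finite connected simple graph cellularly embedded in the 2-sphere, with every face bounded by a cycle with at least three vertices, together with a distinguished face, whose boundary is $\partial P$, such that there are at least two other faces, namely the $P_j$.) A *path* in $\mathcal G$ is a finite sequence of vertices $v_0,\dots,v_{n+1}$ in which consecutive vertices form an edge. It is *proper* if its end points lie on $\partial P$ and its interior is disjoint from $\partial P$. For distinct vertices $a,b\in\partial P$, let $\Gamma_{a,b}$ be the family of proper paths that connect $a$ and $b$, and let $\Gamma^*_{a,b}$ be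 the family of proper paths that separate $a$ and $b$, that is, proper paths that connect the two components of $\partial P-\{a,b\}$. A *vertex metric* is a function $\mu:\mathcal V\to[0,\infty)$; its area is $\sum_{v\in\mathcal V}\mu(v)^2$, and the $\mu$-length of a path $v_0,\dots,v_{n+1}$ is $\sum_{j=0}^{n+1}\mu(v_j)$. For a family $\Gamma$ of paths, the *relative vertex extremal width* $\mathrm{EW}(\Gamma,\partial P)\in[0,\infty]$ is the infimum of the areas of the vertex metrics that vanish at all vertices of $\partial P$ and give every path of $\Gamma$ length at least $1$ (with $\inf\emptyset=\infty$). The *relative vertex extremal length* is $\mathrm{EL}(\Gamma,\partial P)=1/\mathrm{EW}(\Gamma,\partial P)$. **Theorem.** Let $(\mathcal G,\partial P)$ be a simple polygonal subdivision graph with subdivision complexity $N$. Let $a\neq b$ be vertices of $\partial P$ that are not adjacent in $\partial P$, and suppose that $\Gamma_{a,b}$ and $\Gamma^*_{a,b}$ are both non-empty. 1. (Duality) If $N=3$, i.e. $\mathcal R(P)$ is a triangulation, then $$\mathrm{EW}(\Gamma_{a,b},\partial P)\cdot\mathrm{EW}(\Gamma^*_{a,b},\partial P)=1.$$ 2. (Quasi-duality)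 In general, $$\frac{1}{(4N+1)^2}\le \mathrm{EW}(\Gamma_{a,b},\partial P)\cdot\mathrm{EW}(\Gamma^*_{a,b},\partial P)\le 1,$$ and equivalently $$1\le \mathrm{EL}(\Gamma_{a,b},\partial P)\cdot\mathrm{EL}(\Gamma^*_{a,b},\partial P)\le (4N+1)^2.$$ -/

import Mathlib

open scoped NNReal ENNReal

/-! ### Vertex extremal width of a family of paths in a graph -/

namespace VertexWidth

variable {V : Type*} {G : SimpleGraph V}

/-- A path in `G` in the sense used here: a sequence of vertices in which any two consecutive
ones form an edge (repetitions are allowed), packaged together with its two end points. -/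
abbrev GraphPath (G : SimpleGraph V) := Σ u v : V, G.Walk u v

/-- The length of a path for the vertex metric `μ`: the sum of `μ` over the vertices visited,
end points included. -/
def length (μ : V → ℝ≥0) (γ : GraphPath G) : ℝ≥0 := (γ.2.2.support.map μ).sum

/-- The area of a vertex metric. -/
def area [Fintype V] (μ : V → ℝ≥0) : ℝ≥0 := ∑ v, μ v ^ 2

/-- `μ` is `Γ`-admissible relative to `W`. -/
def Admissible (Γ : Set (GraphPath G)) (W : Set V) (μ : V → ℝ≥0) : Prop :=
  (∀ γ ∈ Γ, 1 ≤ length μ γ) ∧ ∀ v ∈ W, μ v = 0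

/-- Relative vertex extremal width: the infimum of the areas of the metrics that are
`Γ`-admissible relative to `W` (it is `∞` when there is no such metric). -/
noncomputable def EW [Fintype V] (Γ : Set (GraphPath G)) (W : Set V) : ℝ≥0∞ :=
  ⨅ (μ : V → ℝ≥0) (_ : Admissible Γ W μ), (area μ : ℝ≥0∞)

/-- Relative vertex extremal length. -/
noncomputable def EL [Fintype V] (Γ : Set (GraphPath G)) (W : Set V) : ℝ≥0∞ := 1 / EW Γ W

end VertexWidth

/-! ### Polygonal subdivisions -/

/-- A rotation system on a simple graph: a permutation of the darts (oriented edges) that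
permutes the darts issuing from each vertex in a single cycle, namely their counterclockwise
order around that vertex. It describes a cellular embedding of the graph in a closed oriented
surface. -/
structure RotationSystem {V : Type*} (G : SimpleGraph V) where
  rot : Equiv.Perm G.Dart
  rot_fst : ∀ d, (rot d).fst = d.fst
  rot_sameCycle : ∀ d d', d.fst = d'.fst → rot.SameCycle d d'

namespace RotationSystem

variable {V : Type*} {G : SimpleGraph V} (R : RotationSystem G)

/-- The next dart on the boundary of the face that lies beside a given dart: go along `d`, then
leave its head along the dart that follows the reversal of `d` in the rotation. -/
def next : Equiv.Perm G.Dart :=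
  (Function.Involutive.toPerm SimpleGraph.Dart.symm SimpleGraph.Dart.symm_involutive).trans R.rot

/-- The faces: the cycles of `next`. -/
def Face : Type _ := Quotient (Equiv.Perm.SameCycle.setoid R.next)

/-- The face beside a dart. -/
def faceOf (d : G.Dart) : R.Face := Quotient.mk (Equiv.Perm.SameCycle.setoid R.next) d

/-- The vertices on the boundary of a face. -/
def faceVerts (F : R.Face) : Set V := {v | ∃ d : G.Dart, R.faceOf d = F ∧ d.fst = v}

end RotationSystem

/-- A polygonal subdivision `R(P)` of a polygon `P` (a cell structure on a closed disk) with
finite simple 1-skeleton `G`, presented combinatorially. Gluing a further 2-cell `outer` to the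
disk along `∂P` gives a cell structure on the 2-sphere, i.e. a rotation system on the connected
graph `G` whose Euler characteristic is `2`. The 2-cells of `R(P)` are the faces other than
`outer`, and `∂P` is the boundary of `outer`; in particular an edge of `∂P` is an edge of `G`
and has no vertex in its interior. -/
structure PolygonalSubdivision {V : Type*} [Fintype V] (G : SimpleGraph V)
    extends RotationSystem G where
  connected : G.Connected
  /-- Euler's formula for the sphere. -/
  euler : Nat.card V + Nat.card toRotationSystem.Face = Nat.card G.edgeSet + 2
  /-- The complement of the polygon `P`. -/
  outer : toRotationSystem.Face
  /-- Every face (and also `P` itself) is a closed disk: its boundary does not meet a vertex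
  twice. -/
  face_embedded : ∀ d d', toRotationSystem.faceOf d = toRotationSystem.faceOf d' →
    d.fst = d'.fst → d = d'
  /-- Polygons have at least three vertices. -/
  three_le : ∀ F, 3 ≤ (toRotationSystem.faceVerts F).ncard
  /-- The polygon is decomposed into at least two 2-cells. -/
  two_le_card : 2 ≤ Nat.card {F : toRotationSystem.Face // F ≠ outer}

namespace PolygonalSubdivision

open VertexWidth

variable {V : Type*} [Fintype V] {G : SimpleGraph V} (R : PolygonalSubdivision G)

/-- The subdivision complexity: the largest number of vertices of a 2-cell of `R(P)`. There are
finitely many 2-cells and at least one, so this supremum is a maximum. -/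
noncomputable def complexity : ℕ :=
  ⨆ F : {F : R.Face // F ≠ R.outer}, (R.faceVerts F).ncard

/-- The boundary cycle `∂P`, as a subgraph of `G`. -/
def boundary : G.Subgraph where
  verts := R.faceVerts R.outer
  Adj u v := ∃ d : G.Dart, R.faceOf d = R.outer ∧ d.edge = s(u, v)
  adj_sub := by
    rintro u v ⟨d, -, hd⟩
    have := d.edge_mem
    rwa [hd] at this
  edge_vert := by
    rintro u v ⟨d, hF, hd⟩
    have h : R.next d = R.rot d.symm := rfl
    rw [SimpleGraph.dart_edge_eq_mk'_iff'] at hd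
    rcases hd with ⟨h1, -⟩ | ⟨-, h2⟩
    · exact ⟨d, hF, h1⟩
    · refine ⟨R.next d, ?_, ?_⟩
      · rw [← hF]
        exact Quotient.sound (s := Equiv.Perm.SameCycle.setoid R.next)
          (Equiv.Perm.sameCycle_apply_left.2 (Equiv.Perm.SameCycle.refl _ _))
      · rw [h, R.rot_fst]
        exact h2
  symm := by
    constructor
    rintro u v ⟨d, hF, hd⟩
    exact ⟨d, hF, hd.trans Sym2.eq_swap⟩

/-- A path is proper relative to `∂P`: its end points lie on `∂P`, and its interior (made of its
intermediate vertices and its open edges) is disjoint from `∂P`. -/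
def IsProper {u v : V} (w : G.Walk u v) : Prop :=
  u ∈ R.boundary.verts ∧ v ∈ R.boundary.verts ∧
    (∀ i, 0 < i → i < w.length → w.getVert i ∉ R.boundary.verts) ∧
    ∀ e ∈ w.edges, e ∉ R.boundary.edgeSet

/-- The family of proper paths that connect `a` and `b`. -/
def connecting (a b : V) : Set (GraphPath G) :=
  {γ | R.IsProper γ.2.2 ∧ γ.1 = a ∧ γ.2.1 = b}

/-- The family of proper paths that separate `a` and `b`: those that connect the two components
of `∂P - {a, b}`, i.e. whose end points lie in different components of `∂P - {a, b}`. -/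
def separating (a b : V) : Set (GraphPath G) :=
  {γ | R.IsProper γ.2.2 ∧
    ∃ (hu : γ.1 ∈ (R.boundary.deleteVerts {a, b}).verts)
      (hv : γ.2.1 ∈ (R.boundary.deleteVerts {a, b}).verts),
      ¬ (R.boundary.deleteVerts {a, b}).coe.Reachable ⟨γ.1, hu⟩ ⟨γ.2.1, hv⟩}

end PolygonalSubdivision

/-! For the upper bound, a path joining `a` to `b` and a path separating them always cross at an
interior vertex. Hence the indicator of the interior vertices of a separating path is admissible for
the connecting family. If `f` has least area `M` among metrics admissible for that family, the
variational inequality `M ≤ ⟨f, g⟩` for all admissible `g`, applied to these indicators, shows that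
`f / M` is admissible for the separating family. Its area is `1 / M` (`exists_admissible_pair`).

For the lower bound, let `μ` be admissible for the connecting family. The level sets of the
`μ`-distance from `a` are cuts between `a` and `b`, and a discrete coarea inequality shows that `μ`
dominates a probability combination of them (`exists_weights_of_admissible`). By the Hex property
(`exists_reachThrough_withCells`), each cut together with the 2-cells carries a path between the two
boundary arcs.

In a triangulation the cells can be bypassed along edges, so each cut has mass at least `1` for
every metric `ν` admissible for the separating family. Averaging gives `∑ μ ν ≥ 1`, and
Cauchy–Schwarz concludes.

In general the paths use cells. Charging each cell to a vertex of the cut next to it on the path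
gives a random path in the coned graph whose area exceeds that of `μ` by a factor at most `4 N + 1`
(`sum_weight_sq_le`). The same construction from `ν` gives a random path in the transverse
direction. The two always cross, at a vertex or at a cell, so Cauchy–Schwarz yields the constant `(4
N + 1)²`.

Planar topology enters twice: crossing of transverse paths (`exists_mem_support_inter`) comes from
the vanishing of first homology modulo `2`, a consequence of Euler's formula, while the Hex property
is a Sperner-type parity count. -/

namespace RotationSystem

/-! ### Faces of a rotation system and the coned graph. -/

variable {V : Type*} {G : SimpleGraph V} (R : RotationSystem G)

theorem next_apply (d : G.Dart) : R.next d = R.rot d.symm := rfl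

theorem next_fst (d : G.Dart) : (R.next d).fst = d.snd := R.rot_fst _

theorem next_symm (d : G.Dart) : R.next d.symm = R.rot d := by
  rw [next_apply, SimpleGraph.Dart.symm_symm]

theorem next_ne (d : G.Dart) : R.next d ≠ d := fun h =>
  d.adj.ne (by rw [← R.next_fst d, h])

theorem faceOf_eq_iff {d d' : G.Dart} : R.faceOf d = R.faceOf d' ↔ R.next.SameCycle d d' :=
  Quotient.eq (r := Equiv.Perm.SameCycle.setoid R.next)

theorem faceOf_next (d : G.Dart) : R.faceOf (R.next d) = R.faceOf d :=
  R.faceOf_eq_iff.2 (Equiv.Perm.sameCycle_apply_left.2 (Equiv.Perm.SameCycle.refl _ _))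

theorem exists_faceOf_eq (F : R.Face) : ∃ d, R.faceOf d = F := Quotient.exists_rep F

theorem fst_mem_faceVerts (d : G.Dart) : d.fst ∈ R.faceVerts (R.faceOf d) := ⟨d, rfl, rfl⟩

theorem snd_mem_faceVerts (d : G.Dart) : d.snd ∈ R.faceVerts (R.faceOf d) :=
  ⟨R.next d, R.faceOf_next d, R.next_fst d⟩

instance [Finite V] : Finite G.Dart :=
  Finite.of_injective (fun d => d.toProd) SimpleGraph.Dart.toProd_injective

instance [Finite V] : Finite R.Face := Quotient.finite _

/-- The 1-skeleton of the cell structure obtained by coning every face: the vertices are those of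
`G` together with the faces, each face being joined to the vertices on its boundary. -/
def cone : SimpleGraph (V ⊕ R.Face) where
  Adj
    | .inl u, .inl v => G.Adj u v
    | .inl v, .inr F => v ∈ R.faceVerts F
    | .inr F, .inl v => v ∈ R.faceVerts F
    | .inr _, .inr _ => False
  symm := by
    constructor
    rintro (u | F) (v | F') h
    · exact SimpleGraph.Adj.symm h
    · exact h
    · exact h
    · exact h
  loopless := by
    constructor
    rintro (u | F) h
    · exact SimpleGraph.irrefl _ h
    · exact h

@[simp] theorem cone_adj_inl_inl {u v : V} : R.cone.Adj (.inl u) (.inl v) ↔ G.Adj u v := Iff.rfl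
@[simp] theorem cone_adj_inl_inr {v : V} {F : R.Face} :
    R.cone.Adj (.inl v) (.inr F) ↔ v ∈ R.faceVerts F := Iff.rfl
@[simp] theorem cone_adj_inr_inl {v : V} {F : R.Face} :
    R.cone.Adj (.inr F) (.inl v) ↔ v ∈ R.faceVerts F := Iff.rfl
@[simp] theorem cone_adj_inr_inr {F F' : R.Face} : ¬ R.cone.Adj (.inr F) (.inr F') := id

/-- The inclusion of `G` into the coned graph. -/
def toCone : G →g R.cone where
  toFun := .inl
  map_rel' h := h

/-- The edge of the coned graph given by a dart of `G`. -/
def base (d : G.Dart) : R.cone.edgeSet := ⟨s(.inl d.fst, .inl d.snd), R.cone.mem_edgeSet.2 (R.cone_adj_inl_inl.2 d.adj)⟩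

/-- The edge of the coned graph that joins the tail of a dart to the face beside it. -/
def spoke (d : G.Dart) : R.cone.edgeSet :=
  ⟨s(.inl d.fst, .inr (R.faceOf d)),
    R.cone.mem_edgeSet.2 (R.cone_adj_inl_inr.2 (R.fst_mem_faceVerts d))⟩

theorem base_eq_iff {d d' : G.Dart} : R.base d = R.base d' ↔ d' = d ∨ d' = d.symm := by
  rw [base, base, Subtype.mk.injEq, Sym2.eq_iff]
  simp only [Sum.inl.injEq, SimpleGraph.Dart.ext_iff, Prod.ext_iff]
  simp [eq_comm]
  tauto

theorem base_ne_spoke (d d' : G.Dart) : R.base d ≠ R.spoke d' := by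
  simp [base, spoke]

theorem exists_base_or_spoke (e : R.cone.edgeSet) :
    (∃ d, R.base d = e) ∨ ∃ d, R.spoke d = e := by
  obtain ⟨e, he⟩ := e
  induction e with | _ p q =>
  rcases p with u | F <;> rcases q with v | F'
  · exact .inl ⟨⟨(u, v), he⟩, rfl⟩
  · obtain ⟨d, rfl, rfl⟩ := he
    exact .inr ⟨d, rfl⟩
  · obtain ⟨d, rfl, rfl⟩ := he
    exact .inr ⟨d, Subtype.ext Sym2.eq_swap⟩
  · exact he.elim

end RotationSystem

/-! ### Chains modulo 2 on a finite graph. -/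

namespace SimpleGraph

open scoped Classical

variable {W : Type*} (H : SimpleGraph W)

theorem pi_zmod_two_add_self {α : Type*} (f : α → ZMod 2) : f + f = 0 :=
  funext fun _ => CharTwo.add_self_eq_zero _

/-- The two end points of an edge, as a `0`-chain modulo `2`. -/
noncomputable def endpointChain : Sym2 W → W → ZMod 2 :=
  Sym2.lift ⟨fun p q => Pi.single p 1 + Pi.single q 1, fun _ _ => add_comm _ _⟩

theorem endpointChain_mk [DecidableEq W] (p q : W) :
    endpointChain s(p, q) = Pi.single p 1 + Pi.single q 1 := by
  ext x
  simp only [endpointChain, Sym2.lift_mk, Pi.add_apply, Pi.single_apply]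
  congr!

variable {H}

/-- The `1`-chain modulo `2` traversed by a walk. -/
noncomputable def Walk.chain {u : W} : ∀ {v : W}, H.Walk u v → H.edgeSet → ZMod 2 := fun {_} p =>
  Walk.rec (motive := fun _ _ _ => H.edgeSet → ZMod 2) (fun {_} => 0)
    (fun {u v _} h _ c => Pi.single ⟨s(u, v), h⟩ 1 + c) p

theorem Walk.chain_cons {u v w : W} [DecidableEq H.edgeSet] (h : H.Adj u v) (p : H.Walk v w) :
    (Walk.cons h p).chain = Pi.single ⟨s(u, v), h⟩ 1 + p.chain := by
  ext x
  simp [chain, Pi.single_apply]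

theorem Walk.chain_eq_zero {u v : W} (p : H.Walk u v) (e : H.edgeSet) (x : W)
    (hx : x ∈ (e : Sym2 W)) (hp : x ∉ p.support) : p.chain e = 0 := by
  induction p with
  | nil => rfl
  | @cons u v w h p ih =>
    rw [support_cons, List.mem_cons, not_or] at hp
    rw [chain_cons, Pi.add_apply, ih hp.2, add_zero]
    refine Pi.single_eq_of_ne ?_ _
    rintro rfl
    rcases Sym2.mem_iff.1 hx with rfl | rfl
    · exact hp.1 rfl
    · exact hp.2 p.start_mem_support

variable (H) [Fintype W]

/-- The boundary map from `1`-chains to `0`-chains modulo `2` of a finite graph. -/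
noncomputable def boundaryMap : (H.edgeSet → ZMod 2) →ₗ[ZMod 2] W → ZMod 2 :=
  Fintype.linearCombination (ZMod 2) fun e : H.edgeSet => endpointChain (e : Sym2 W)

theorem boundaryMap_single [DecidableEq H.edgeSet] (e : H.edgeSet) :
    H.boundaryMap (Pi.single e 1) = endpointChain (e : Sym2 W) := by
  rw [boundaryMap, Fintype.linearCombination_apply_single, one_smul]

variable {H}

theorem Walk.boundaryMap_chain [DecidableEq W] {u v : W} (p : H.Walk u v) :
    H.boundaryMap p.chain = Pi.single u 1 + Pi.single v 1 := by
  induction p with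
  | nil =>
    rw [pi_zmod_two_add_self]
    exact map_zero _
  | @cons u v w h p ih =>
    rw [chain_cons, map_add, ih, boundaryMap_single, endpointChain_mk]
    have := pi_zmod_two_add_self (Pi.single v 1 : W → ZMod 2)
    rw [add_assoc, ← add_assoc (Pi.single v 1), this, zero_add]

/-- A walk from `p` to `p₀` has boundary `p + p₀`, so the boundaries together with the single point
`p₀` span all `0`-chains. -/
theorem card_le_finrank_range_boundaryMap (hH : H.Connected) :
    Fintype.card W ≤ Module.finrank (ZMod 2) (LinearMap.range H.boundaryMap) + 1 := by
  obtain ⟨p₀⟩ := hH.nonempty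
  have key : (⊤ : Submodule (ZMod 2) (W → ZMod 2)) ≤
      LinearMap.range H.boundaryMap ⊔ Submodule.span (ZMod 2) {Pi.single p₀ 1} := by
    rw [← (Pi.basisFun (ZMod 2) W).span_eq, Submodule.span_le]
    rintro _ ⟨p, rfl⟩
    obtain ⟨w⟩ := hH.preconnected p p₀
    rw [Pi.basisFun_apply, SetLike.mem_coe, Submodule.mem_sup]
    refine ⟨_, ⟨w.chain, rfl⟩, _, Submodule.mem_span_singleton_self _, ?_⟩
    rw [w.boundaryMap_chain, add_assoc, pi_zmod_two_add_self, add_zero]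
  have h1 := Submodule.finrank_mono key
  rw [finrank_top, Module.finrank_fintype_fun_eq_card] at h1
  refine h1.trans ((Submodule.finrank_add_le_finrank_add_finrank _ _).trans ?_)
  gcongr
  exact (finrank_span_le_card _).trans (by simp)

end SimpleGraph

/-! ### Vanishing of the first homology of the coned sphere. -/

namespace RotationSystem

open scoped Classical
open SimpleGraph

variable {V : Type*} [Fintype V] {G : SimpleGraph V} (R : RotationSystem G)

noncomputable instance : Fintype R.Face := Fintype.ofFinite _

/-- The boundary map from `2`-chains to `1`-chains modulo `2`: a dart stands for the triangle
spanned by it and the face beside it. -/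
noncomputable def triangleMap : (G.Dart → ZMod 2) →ₗ[ZMod 2] R.cone.edgeSet → ZMod 2 :=
  Fintype.linearCombination (ZMod 2) fun d : G.Dart =>
    Pi.single (R.base d) 1 + Pi.single (R.spoke d) 1 + Pi.single (R.spoke (R.next d)) 1

theorem triangleMap_apply (Φ : G.Dart → ZMod 2) (e : R.cone.edgeSet) :
    R.triangleMap Φ e = ∑ d, (Φ d * (if e = R.base d then 1 else 0) +
      Φ d * (if e = R.spoke d then 1 else 0) +
      Φ d * (if e = R.spoke (R.next d) then 1 else 0)) := by
  simp [triangleMap, Fintype.linearCombination_apply, Finset.sum_apply, Pi.single_apply]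

theorem triangleMap_base (Φ : G.Dart → ZMod 2) (d : G.Dart) :
    R.triangleMap Φ (R.base d) = Φ d + Φ d.symm := by
  rw [triangleMap_apply]
  simp only [R.base_ne_spoke, if_false, mul_zero, add_zero]
  simp only [R.base_eq_iff, mul_ite, mul_one, mul_zero]
  rw [← Finset.sum_filter, show Finset.univ.filter (fun x => x = d ∨ x = d.symm) = {d, d.symm} by
    ext; simp]
  exact Finset.sum_pair d.symm_ne.symm

theorem boundaryMap_triangleMap (Φ : G.Dart → ZMod 2) :
    R.cone.boundaryMap (R.triangleMap Φ) = 0 := by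
  rw [triangleMap, Fintype.linearCombination_apply, map_sum]
  refine Finset.sum_eq_zero fun d _ => ?_
  rw [map_smul, map_add, map_add, boundaryMap_single, boundaryMap_single, boundaryMap_single]
  simp only [base, spoke, endpointChain_mk, R.next_fst, R.faceOf_next]
  have h : ∀ x y z : V ⊕ R.Face → ZMod 2, x + y + (x + z) + (y + z) = 0 := fun x y z => by
    rw [show x + y + (x + z) + (y + z) = (x + x) + (y + y) + (z + z) by abel,
      pi_zmod_two_add_self x, pi_zmod_two_add_self y, pi_zmod_two_add_self z, add_zero, add_zero]
  rw [h, smul_zero]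

end RotationSystem

namespace PolygonalSubdivision

open scoped Classical
open SimpleGraph RotationSystem

variable {V : Type*} [Fintype V] {G : SimpleGraph V} (R : PolygonalSubdivision G)

theorem spoke_injective : Function.Injective R.spoke := by
  intro d d' h
  rw [spoke, spoke, Subtype.mk.injEq, Sym2.eq_iff] at h
  simp only [Sum.inl.injEq, Sum.inr.injEq, reduceCtorEq, and_self, or_false] at h
  exact R.face_embedded d d' h.2 h.1

theorem triangleMap_spoke_next (Φ : G.Dart → ZMod 2) (d : G.Dart) :
    R.triangleMap Φ (R.spoke (R.next d)) = Φ (R.next d) + Φ d := by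
  rw [triangleMap_apply]
  simp only [fun x => (R.base_ne_spoke x (R.next d)).symm, if_false, mul_zero, zero_add,
    R.spoke_injective.eq_iff, R.next.injective.eq_iff, Finset.sum_add_distrib, mul_ite, mul_one,
    Finset.sum_ite_eq, Finset.mem_univ, if_true]

/-- Since `rot d = next d.symm`, such a function is constant around each vertex. Reversing darts
transports the value along edges, and `G` is connected. -/
theorem const_of_next_symm {α : Type*} (Φ : G.Dart → α) (h1 : ∀ d, Φ (R.next d) = Φ d)
    (h2 : ∀ d, Φ d.symm = Φ d) (d d' : G.Dart) : Φ d = Φ d' := by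
  have key : ∀ d d' : G.Dart, d.fst = d'.fst → Φ d = Φ d' := by
    intro d d' h
    obtain ⟨n, -, rfl⟩ := (R.rot_sameCycle d d' h).exists_pow_eq'
    clear h
    induction n with
    | zero => rfl
    | succ n ih =>
      rw [ih, pow_succ', Equiv.Perm.mul_apply, ← R.next_symm, h1, h2]
  obtain ⟨w⟩ := R.connected.preconnected d.fst d'.fst
  generalize hu : d.fst = u at w
  generalize hv : d'.fst = v at w
  induction w generalizing d with
  | nil => exact key _ _ (hu.trans hv.symm)
  | @cons u v w h p ih =>
    rw [key d ⟨(u, v), h⟩ hu, ← h2]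
    exact ih _ rfl hv

/-- The coefficient of the boundary at an edge or a spoke compares the two triangles that share it,
so a `2`-cycle is constant. -/
theorem finrank_ker_triangleMap_le :
    Module.finrank (ZMod 2) (LinearMap.ker R.triangleMap) ≤ 1 := by
  obtain ⟨d₀, -⟩ := R.exists_faceOf_eq R.outer
  refine (Submodule.finrank_mono (t := Submodule.span (ZMod 2) {1}) ?_).trans
    ((finrank_span_le_card _).trans (by simp))
  intro Φ hΦ
  rw [LinearMap.mem_ker] at hΦ
  refine Submodule.mem_span_singleton.2 ⟨Φ d₀, funext fun d => ?_⟩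
  rw [Pi.smul_apply, Pi.one_apply, smul_eq_mul, mul_one]
  refine R.const_of_next_symm Φ (fun d => ?_) (fun d => ?_) _ _
  · rw [← CharTwo.add_eq_zero, ← R.triangleMap_spoke_next, hΦ, Pi.zero_apply]
  · rw [eq_comm, ← CharTwo.add_eq_zero, ← R.triangleMap_base, hΦ, Pi.zero_apply]

theorem cone_connected : R.cone.Connected := by
  have hV : ∀ u v : V, R.cone.Reachable (.inl u) (.inl v) := fun u v =>
    (R.connected.preconnected u v).map R.toCone
  have hF : ∀ F : R.Face, ∃ v : V, R.cone.Reachable (.inr F) (.inl v) := fun F => by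
    obtain ⟨d, rfl⟩ := R.exists_faceOf_eq F
    exact ⟨d.fst, (R.cone_adj_inr_inl.2 (R.fst_mem_faceVerts d)).reachable⟩
  have h : ∀ p : V ⊕ R.Face, ∃ v : V, R.cone.Reachable p (.inl v) := by
    rintro (u | F)
    exacts [⟨u, .refl _⟩, hF F]
  refine @Connected.mk _ _ (fun p q => ?_) (R.connected.nonempty.map .inl)
  obtain ⟨u, hu⟩ := h p
  obtain ⟨v, hv⟩ := h q
  exact hu.trans ((hV u v).trans hv.symm)

theorem card_cone_edgeSet_le :
    Fintype.card R.cone.edgeSet ≤ Nat.card G.edgeSet + Fintype.card G.Dart := by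
  rw [Nat.card_eq_fintype_card, ← Fintype.card_sum]
  let f : G.edgeSet ⊕ G.Dart → Sym2 (V ⊕ R.Face) :=
    Sum.elim (fun e => e.1.map .inl) fun d => R.spoke d
  have : (R.cone.edgeSet : Set (Sym2 (V ⊕ R.Face))) ⊆ Set.range f := by
    intro e he
    rcases R.exists_base_or_spoke ⟨e, he⟩ with ⟨d, hd⟩ | ⟨d, hd⟩
    · exact ⟨.inl ⟨d.edge, d.edge_mem⟩, congrArg Subtype.val hd⟩
    · exact ⟨.inr d, congrArg Subtype.val hd⟩
  calc _ ≤ Fintype.card (Set.range f) := Set.card_le_card this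
    _ ≤ _ := Fintype.card_range_le f

/-- On the sphere, every `1`-cycle modulo `2` is a sum of boundaries of triangles. -/
theorem exists_triangleMap_eq (x : R.cone.edgeSet → ZMod 2) (hx : R.cone.boundaryMap x = 0) :
    ∃ Φ, R.triangleMap Φ = x := by
  have hle : LinearMap.range R.triangleMap ≤ LinearMap.ker R.cone.boundaryMap := by
    rintro _ ⟨Φ, rfl⟩
    exact R.boundaryMap_triangleMap Φ
  have h1 := LinearMap.finrank_range_add_finrank_ker R.triangleMap
  have h2 := LinearMap.finrank_range_add_finrank_ker R.cone.boundaryMap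
  rw [Module.finrank_fintype_fun_eq_card] at h1 h2
  have h3 := card_le_finrank_range_boundaryMap R.cone_connected
  have h4 := R.finrank_ker_triangleMap_le
  have h5 := R.card_cone_edgeSet_le
  have h6 : Fintype.card G.Dart = 2 * Nat.card G.edgeSet := by
    rw [dart_card_eq_twice_card_edges, Nat.card_eq_fintype_card, edgeFinset_card]
  have h7 := R.euler
  rw [Nat.card_eq_fintype_card (α := V), Nat.card_eq_fintype_card (α := R.Face),
    ← Fintype.card_sum] at h7
  -- With `E` edges in `G`, the range has dimension at least `2E - 1`. The cycle space has dimension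
  -- at most `3E - (|V| + |F| - 1)`, which is `2E - 1` by Euler's formula.
  have : LinearMap.range R.triangleMap = LinearMap.ker R.cone.boundaryMap :=
    Submodule.eq_of_le_of_finrank_le hle (by omega)
  exact LinearMap.mem_range.1 (this ▸ LinearMap.mem_ker.2 hx)

end PolygonalSubdivision

/-! ### Arcs of a cycle of a permutation. -/

namespace Equiv.Perm

variable {α : Type*} {σ : Equiv.Perm α} {x y z w : α}

/-- The elements that are met when iterating `σ` from `x` on, before `y` is reached. -/
def Arc (σ : Equiv.Perm α) (x y z : α) : Prop :=
  ∃ i : ℕ, (σ ^ i) x = z ∧ ∀ j ≤ i, (σ ^ j) x ≠ y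

theorem arc_self (h : x ≠ y) : σ.Arc x y x :=
  ⟨0, rfl, fun j hj => by rwa [Nat.le_zero.1 hj]⟩

theorem not_arc_right : ¬ σ.Arc x y y := fun ⟨i, hi, h⟩ => h i le_rfl hi

theorem Arc.apply (h : σ.Arc x y z) (hz : σ z ≠ y) : σ.Arc x y (σ z) := by
  obtain ⟨i, rfl, hi⟩ := h
  refine ⟨i + 1, by rw [pow_succ', mul_apply], fun j hj => ?_⟩
  rcases Nat.le_succ_iff.1 hj with h | rfl
  · exact hi j h
  · rwa [pow_succ', mul_apply]

theorem Arc.of_apply (h : σ.Arc x y (σ z)) (hz : σ z ≠ x) : σ.Arc x y z := by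
  obtain ⟨_ | i, hi, h⟩ := h
  · exact (hz hi.symm).elim
  · rw [pow_succ', mul_apply] at hi
    exact ⟨i, σ.injective hi, fun j hj => h j (by omega)⟩

theorem arc_apply_iff (hx : σ z ≠ x) (hy : σ z ≠ y) : σ.Arc x y (σ z) ↔ σ.Arc x y z :=
  ⟨fun h => h.of_apply hx, fun h => h.apply hy⟩

variable [Finite α]

/-- If `z` were reached before `y`, the iteration would close up at `x` and run through the whole
cycle without meeting `y`. -/
theorem not_arc_of_apply_eq_left (hxy : σ.SameCycle x y) (hz : σ z = x) : ¬ σ.Arc x y z := by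
  rintro ⟨i, rfl, h⟩
  obtain ⟨n, -, hn⟩ := hxy.exists_pow_eq'
  have hper : (σ ^ (i + 1)) x = x := by rwa [pow_succ', mul_apply]
  refine h (n % (i + 1)) (Nat.lt_succ_iff.1 (Nat.mod_lt _ i.succ_pos)) ?_
  have hq : ∀ q : ℕ, (σ ^ ((i + 1) * q)) x = x := fun q => by
    rw [pow_mul]
    exact pow_apply_eq_self_of_apply_eq_self hper q
  rw [← hn]
  conv_rhs => rw [← Nat.mod_add_div n (i + 1), pow_add, mul_apply, hq]

theorem arc_of_apply_eq_right (hxy : σ.SameCycle x y) (hne : x ≠ y) (hz : σ z = y) :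
    σ.Arc x y z := by
  classical
  have hex : ∃ n : ℕ, (σ ^ n) x = y := by
    obtain ⟨n, -, hn⟩ := hxy.exists_pow_eq'
    exact ⟨n, hn⟩
  have hs := Nat.find_spec hex
  have hm := fun j => Nat.find_min (m := j) hex
  generalize Nat.find hex = n at hs hm
  obtain _ | n := n
  · exact (hne hs).elim
  · rw [pow_succ', mul_apply, ← hz] at hs
    exact ⟨n, σ.injective hs, fun j hj => hm j (by omega)⟩

open scoped Classical in
/-- A function modulo `2` on a cycle that changes precisely on entering `x` and `y` distinguishes
the two arcs between `x` and `y`. -/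
theorem arc_iff_of_eq (hxy : σ.SameCycle x y) (hne : x ≠ y) (Φ : α → ZMod 2)
    (hΦ : ∀ z, σ.SameCycle x z →
      Φ (σ z) + Φ z = (if σ z = x then 1 else 0) + (if σ z = y then 1 else 0))
    (hz : σ.SameCycle x z) (hw : σ.SameCycle x w) (h : Φ z = Φ w) :
    σ.Arc x y z ↔ σ.Arc x y w := by
  -- Starting at `x`, the value flips on entering `y` and flips back on returning to `x`.
  have key : ∀ z, σ.SameCycle x z → Φ z = Φ x + if σ.Arc x y z then 0 else 1 := by
    intro z hz
    obtain ⟨n, -, rfl⟩ := hz.exists_pow_eq'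
    clear hz
    induction n with
    | zero => simp [arc_self hne]
    | succ n ih =>
      have h1 := hΦ ((σ ^ n) x) ⟨n, by simp⟩
      rw [pow_succ', mul_apply]
      rw [ih] at h1
      generalize (σ ^ n) x = u at *
      generalize Φ x = c at *
      generalize Φ (σ u) = c' at *
      by_cases hx : σ u = x
      · have hy : ¬ σ u = y := hx ▸ hne
        simp only [if_pos hx, if_neg hy, if_neg (not_arc_of_apply_eq_left hxy hx)] at h1
        simp only [hx, if_pos (arc_self hne)]
        clear ih; revert h1 c c'; clear * -; decide
      · by_cases hy : σ u = y
        · simp only [if_neg hx, if_pos hy, if_pos (arc_of_apply_eq_right hxy hne hy)] at h1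
          simp only [hy, if_neg not_arc_right]
          clear ih; revert h1 c c'; clear * -; decide
        · simp only [if_neg hx, if_neg hy] at h1
          simp only [arc_apply_iff hx hy]
          split_ifs at h1 ⊢ <;> (clear ih; revert h1 c c'; clear * -; decide)
  rw [key z hz, key w hw, add_right_inj] at h
  by_cases h1 : σ.Arc x y z <;> by_cases h2 : σ.Arc x y w <;> simp_all

end Equiv.Perm

/-! ### Crossing of transverse paths in the polygon. -/

namespace PolygonalSubdivision

open scoped Classical
open SimpleGraph RotationSystem Equiv.Perm

variable {V : Type*} [Fintype V] {G : SimpleGraph V} (R : PolygonalSubdivision G)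

/-- The darts around a vertex or along a face. -/
def IsAt (d : G.Dart) : V ⊕ R.Face → Prop
  | .inl v => d.fst = v
  | .inr F => R.faceOf d = F

/-- The triangles of the star of `z` are visited cyclically, consecutive ones sharing a cone edge at
`z`. Around a vertex, passing from `c` to `rot c` crosses an edge of `G` and then a spoke; along a
face, each step crosses one spoke. -/
theorem triangle_const (Φ : G.Dart → ZMod 2) (z : V ⊕ R.Face)
    (hΦ : ∀ e : R.cone.edgeSet, z ∈ (e : Sym2 (V ⊕ R.Face)) → R.triangleMap Φ e = 0)
    (d d' : G.Dart) (hd : R.IsAt d z) (hd' : R.IsAt d' z) : Φ d = Φ d' := by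
  rcases z with v | F
  · obtain rfl : d.fst = v := hd
    obtain ⟨n, -, rfl⟩ := (R.rot_sameCycle d d' (Eq.symm hd')).exists_pow_eq'
    clear hd'
    induction n with
    | zero => rfl
    | succ n ih =>
      rw [ih, pow_succ', Equiv.Perm.mul_apply, ← R.next_symm]
      have hfst : ((R.rot ^ n) d).fst = d.fst := by
        clear ih
        induction n with
        | zero => rfl
        | succ n ih => rw [pow_succ', Equiv.Perm.mul_apply, R.rot_fst, ih]
      generalize (R.rot ^ n) d = c at *
      have h1 := hΦ (R.base c) (Sym2.mem_iff.2 (.inl (congrArg _ hfst.symm)))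
      have h2 := hΦ (R.spoke (R.next c.symm)) (Sym2.mem_iff.2 (.inl (congrArg _ (by
        rw [R.next_fst, ← hfst]; rfl))))
      rw [R.triangleMap_base, CharTwo.add_eq_zero] at h1
      rw [R.triangleMap_spoke_next, CharTwo.add_eq_zero] at h2
      rw [h1, h2]
  · obtain rfl : R.faceOf d = F := hd
    obtain ⟨n, -, rfl⟩ := (R.faceOf_eq_iff.1 (Eq.symm hd')).exists_pow_eq'
    clear hd'
    induction n with
    | zero => rfl
    | succ n ih =>
      rw [ih, pow_succ', Equiv.Perm.mul_apply]
      have hf : R.faceOf ((R.next ^ n) d) = R.faceOf d := by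
        clear ih
        induction n with
        | zero => rfl
        | succ n ih => rw [pow_succ', Equiv.Perm.mul_apply, R.faceOf_next, ih]
      generalize (R.next ^ n) d = c at *
      have h2 := hΦ (R.spoke (R.next c)) (Sym2.mem_iff.2 (.inr (congrArg _ (by
        rw [R.faceOf_next, ← hf]))))
      rw [R.triangleMap_spoke_next, CharTwo.add_eq_zero] at h2
      exact h2.symm

theorem exists_isAt_of_adj (Φ : G.Dart → ZMod 2) {z z' : V ⊕ R.Face} (h : R.cone.Adj z z')
    (hΦ : ∀ e : R.cone.edgeSet, z ∈ (e : Sym2 (V ⊕ R.Face)) → R.triangleMap Φ e = 0) :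
    ∃ d d', R.IsAt d z ∧ R.IsAt d' z' ∧ Φ d = Φ d' := by
  rcases z with u | F <;> rcases z' with v | F'
  · let d : G.Dart := ⟨(u, v), h⟩
    have h1 := hΦ (R.base d) (Sym2.mem_iff.2 (.inl rfl))
    rw [R.triangleMap_base, CharTwo.add_eq_zero] at h1
    exact ⟨d, d.symm, rfl, rfl, h1⟩
  · obtain ⟨d, h1, h2⟩ := h
    exact ⟨d, d, h2, h1, rfl⟩
  · obtain ⟨d, h1, h2⟩ := h
    exact ⟨d, d, h1, h2, rfl⟩
  · exact h.elim

/-- The stars of adjacent vertices share a triangle, so the constants of consecutive stars agree. -/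
theorem triangle_const_walk (Φ : G.Dart → ZMod 2) {z z' : V ⊕ R.Face} (p : R.cone.Walk z z')
    (hΦ : ∀ w ∈ p.support, ∀ e : R.cone.edgeSet, w ∈ (e : Sym2 (V ⊕ R.Face)) →
      R.triangleMap Φ e = 0)
    (d d' : G.Dart) (hd : R.IsAt d z) (hd' : R.IsAt d' z') : Φ d = Φ d' := by
  induction p generalizing d with
  | nil => exact R.triangle_const Φ _ (hΦ _ (by simp)) d d' hd hd'
  | @cons u v w h p ih =>
    obtain ⟨c, c', hc, hc', h2⟩ := R.exists_isAt_of_adj Φ h (hΦ u (by simp))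
    have h1 := R.triangle_const Φ _ (hΦ u (by simp)) d c hd hc
    rw [h1, h2]
    exact ih (fun w hw => hΦ w (by simp [hw])) c' hc' hd'

/-- A path through the interior that connects `a` and `b` meets every path through the interior
that connects the two arcs of the boundary between `a` and `b`. -/
theorem exists_mem_support_inter {da db du dv : G.Dart}
    (ha : R.faceOf da = R.outer) (hb : R.faceOf db = R.outer) (hab : da ≠ db)
    (hu : R.faceOf du = R.outer) (hv : R.faceOf dv = R.outer)
    (huv : ¬ (R.next.Arc da db du ↔ R.next.Arc da db dv))
    (p : R.cone.Walk (.inl da.fst) (.inl db.fst)) (hp : .inr R.outer ∉ p.support)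
    (q : R.cone.Walk (.inl du.fst) (.inl dv.fst)) (hq : .inr R.outer ∉ q.support) :
    ∃ z ∈ p.support, z ∈ q.support := by
  by_contra! hdisj
  -- Closing `p` up through the cone point of the outer face gives a cycle, which bounds a `2`-chain
  -- `Φ`. Around the outer face `Φ` jumps exactly at `da` and `db`, so it tells the two arcs apart,
  -- whereas it is constant along a path `q` disjoint from `p`.
  obtain ⟨Φ, hΦ⟩ := R.exists_triangleMap_eq
    (p.chain + (Pi.single (R.spoke da) 1 + Pi.single (R.spoke db) 1)) (by
      rw [map_add, map_add, p.boundaryMap_chain, boundaryMap_single, boundaryMap_single]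
      simp only [spoke, endpointChain_mk, ha, hb]
      have h : ∀ x y z : V ⊕ R.Face → ZMod 2, x + y + (x + z + (y + z)) = 0 := fun x y z => by
        rw [show x + y + (x + z + (y + z)) = (x + x) + (y + y) + (z + z) by abel,
          pi_zmod_two_add_self x, pi_zmod_two_add_self y, pi_zmod_two_add_self z, add_zero,
          add_zero]
      exact h _ _ _)
  refine huv (arc_iff_of_eq (R.faceOf_eq_iff.1 (ha.trans hb.symm)) hab Φ (fun z hz => ?_)
    (R.faceOf_eq_iff.1 (ha.trans hu.symm)) (R.faceOf_eq_iff.1 (ha.trans hv.symm))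
    (R.triangle_const_walk Φ q (fun w hw e he => ?_) du dv rfl rfl))
  · have hz' : R.faceOf z = R.outer := by rw [← ha, eq_comm]; exact R.faceOf_eq_iff.2 hz
    rw [← R.triangleMap_spoke_next, hΦ, Pi.add_apply, Pi.add_apply,
      p.chain_eq_zero _ (.inr R.outer) (Sym2.mem_iff.2 (.inr (by rw [R.faceOf_next, hz']))) hp,
      zero_add, Pi.single_apply, Pi.single_apply]
    simp only [R.spoke_injective.eq_iff]
    congr!
  · have hwp : w ∉ p.support := fun h => hdisj w h hw
    have hs : ∀ d, R.faceOf d = R.outer → .inl d.fst ∈ p.support → e ≠ R.spoke d := by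
      rintro d hd hdp rfl
      rcases Sym2.mem_iff.1 he with rfl | rfl
      · exact hwp hdp
      · exact hq (hd ▸ hw)
    rw [hΦ, Pi.add_apply, Pi.add_apply, p.chain_eq_zero e w he hwp,
      Pi.single_eq_of_ne (hs da ha p.start_mem_support),
      Pi.single_eq_of_ne (hs db hb p.end_mem_support), add_zero, add_zero]

end PolygonalSubdivision

/-! ### Sperner's lemma and the Hex property. -/

namespace SimpleGraph

variable {W : Type*}

/-- The vertices that can be reached from `X` along paths all of whose further vertices are
in `T`. -/
inductive ReachThrough (H : SimpleGraph W) (T X : Set W) : W → Prop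
  | base {x : W} (hx : x ∈ X) : ReachThrough H T X x
  | step {v w : W} (hv : ReachThrough H T X v) (h : H.Adj v w) (hw : w ∈ T) :
      ReachThrough H T X w

variable {H : SimpleGraph W} {T X : Set W}

theorem ReachThrough.mem {v : W} (h : H.ReachThrough T X v) : v ∈ X ∨ v ∈ T := by
  cases h with
  | base hx => exact .inl hx
  | step _ _ hw => exact .inr hw

theorem ReachThrough.exists_walk {v : W} (h : H.ReachThrough T X v) :
    ∃ x ∈ X, ∃ p : H.Walk x v, ∀ u ∈ p.support, u = x ∨ u ∈ T := by
  induction h with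
  | @base x hx => exact ⟨x, hx, .nil, by simp⟩
  | @step v w _ h hw ih =>
    obtain ⟨x, hx, p, hp⟩ := ih
    refine ⟨x, hx, p.concat h, fun u hu => ?_⟩
    rw [Walk.support_concat, List.mem_append, List.mem_singleton] at hu
    rcases hu with hu | rfl
    · exact hp u hu
    · exact .inr hw

end SimpleGraph

namespace PolygonalSubdivision

open scoped Classical
open SimpleGraph RotationSystem

variable {V : Type*} [Fintype V] {G : SimpleGraph V} (R : PolygonalSubdivision G)

/-- The vertices in `S` together with all `2`-cells, as vertices of the coned graph. -/
def withCells (S : Set V) : Set (V ⊕ R.Face) := {z | Sum.elim (· ∈ S) (· ≠ R.outer) z}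

@[simp] theorem inl_mem_withCells {S : Set V} {v : V} : .inl v ∈ R.withCells S ↔ v ∈ S := Iff.rfl
@[simp] theorem inr_mem_withCells {S : Set V} {F : R.Face} :
    .inr F ∈ R.withCells S ↔ F ≠ R.outer := Iff.rfl

theorem fst_mem_boundary {d : G.Dart} (h : R.faceOf d = R.outer) : d.fst ∈ R.boundary.verts :=
  ⟨d, h, rfl⟩

theorem snd_mem_boundary {d : G.Dart} (h : R.faceOf d = R.outer) : d.snd ∈ R.boundary.verts :=
  ⟨R.next d, (R.faceOf_next d).trans h, R.next_fst d⟩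

theorem mixed_parity {u₁ u₂ z₁ z₂ c : Prop} (h₁ : u₁ → ¬ z₁) (h₂ : u₂ → ¬ z₂)
    (h : u₁ ∧ z₂ ∨ z₁ ∧ u₂ → c) (h' : u₁ ∧ ¬ u₂ ∧ ¬ z₂ ∨ u₂ ∧ ¬ u₁ ∧ ¬ z₁ → ¬ c) :
    (if u₁ ∧ z₂ ∨ z₁ ∧ u₂ then 1 else 0 : ZMod 2) +
      ((if u₁ ∧ c then 1 else 0) + if u₂ ∧ c then 1 else 0) = 0 := by
  by_cases u₁ <;> by_cases u₂ <;> by_cases c <;> by_cases z₁ <;> by_cases z₂ <;>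
    simp_all [CharTwo.add_self_eq_zero]

/-- Sperner's lemma on a polygonal subdivision, coned at its `2`-cells. -/
theorem exists_mixed_dart (U Z : Set V) (C : Set R.Face) (hC : R.outer ∉ C)
    (hpar : ∃! d, R.faceOf d = R.outer ∧ (d.fst ∈ U ∧ d.snd ∈ Z ∨ d.fst ∈ Z ∧ d.snd ∈ U))
    (hUZ : Disjoint U Z) :
    ∃ d, R.faceOf d ≠ R.outer ∧
      ((d.fst ∈ U ∧ d.snd ∈ Z ∨ d.fst ∈ Z ∧ d.snd ∈ U) ∧ R.faceOf d ∉ C ∨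
        (d.fst ∈ U ∧ d.snd ∉ U ∧ d.snd ∉ Z ∨ d.snd ∈ U ∧ d.fst ∉ U ∧ d.fst ∉ Z) ∧
          R.faceOf d ∈ C) := by
  -- With the faces in `C` labelled like `Z`, the sum `s d + g d + g (next d)` counts modulo `2` the
  -- edges joining `U` to `Z` in the triangle of `d`. Each edge and spoke is counted twice in all,
  -- so the total is even. The outer face contributes exactly one, hence some inner triangle has an
  -- odd count.
  let s : G.Dart → ZMod 2 := fun d =>
    if d.fst ∈ U ∧ d.snd ∈ Z ∨ d.fst ∈ Z ∧ d.snd ∈ U then 1 else 0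
  let g : G.Dart → ZMod 2 := fun d => if d.fst ∈ U ∧ R.faceOf d ∈ C then 1 else 0
  have hg : ∑ d, (g d + g (R.next d)) = 0 := by
    rw [Finset.sum_add_distrib, Equiv.sum_comp R.next g, CharTwo.add_self_eq_zero]
  have hs : ∑ d, s d = 0 := by
    refine Finset.sum_involution (fun d _ => d.symm) (fun d _ => ?_) (fun d _ _ => d.symm_ne)
      (fun d _ => Finset.mem_univ _) (fun d _ => d.symm_symm)
    have : s d.symm = s d := by
      simp only [s, Dart.symm_toProd, Prod.fst_swap, Prod.snd_swap]
      congr 1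
      rw [eq_iff_iff]
      tauto
    rw [this, CharTwo.add_self_eq_zero]
  by_contra! hcon
  obtain ⟨d₀, ⟨h0, h0'⟩, huniq⟩ := hpar
  have hall : ∑ d, (s d + (g d + g (R.next d))) = 1 := by
    rw [Finset.sum_eq_single d₀]
    · simp [s, g, h0, h0', R.faceOf_next, hC]
    · intro d _ hd
      by_cases ho : R.faceOf d = R.outer
      · have : ¬ (d.fst ∈ U ∧ d.snd ∈ Z ∨ d.fst ∈ Z ∧ d.snd ∈ U) := fun h => hd (huniq d ⟨ho, h⟩)
        simp [s, g, ho, this, R.faceOf_next, hC]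
      · obtain ⟨h1, h2⟩ := hcon d ho
        have d1 : d.fst ∈ U → d.fst ∉ Z := fun h h' => hUZ.notMem_of_mem_left h h'
        have d2 : d.snd ∈ U → d.snd ∉ Z := fun h h' => hUZ.notMem_of_mem_left h h'
        simp only [s, g, R.faceOf_next, R.next_fst]
        exact mixed_parity d1 d2 h1 h2
    · simp
  rw [Finset.sum_add_distrib, hs, hg] at hall
  exact absurd hall (by decide)

/-- The Hex property: if `S` separates `X` from `Y` in the interior, then `S` together with the
`2`-cells contains a path from `X'` to `Y'`. -/
theorem exists_reachThrough_withCells {S X X' Y Y' : Set V} (hS : Disjoint S R.boundary.verts)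
    (hX : X ⊆ R.boundary.verts) (hX' : X' ⊆ R.boundary.verts) (hXX' : Disjoint X X')
    (hcover : R.boundary.verts ⊆ X ∪ X' ∪ Y ∪ Y')
    (hpar : ∃! d, R.faceOf d = R.outer ∧ (d.fst ∈ X ∧ d.snd ∈ X' ∨ d.fst ∈ X' ∧ d.snd ∈ X))
    (hcut : ∀ u y, G.ReachThrough (R.boundary.vertsᶜ \ S) X u → y ∈ Y → ¬ G.Adj u y) :
    ∃ z, ∃ y ∈ Y', R.cone.ReachThrough (R.withCells S) (.inl '' X') z ∧
      R.cone.Adj z (.inl y) := by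
  let U : Set V := {u | G.ReachThrough (R.boundary.vertsᶜ \ S) X u}
  let Z : Set V := {v | R.cone.ReachThrough (R.withCells S) (.inl '' X') (.inl v)}
  let C : Set R.Face := {F | R.cone.ReachThrough (R.withCells S) (.inl '' X') (.inr F)}
  have hU : ∀ v ∈ U, v ∈ X ∨ v ∉ R.boundary.verts ∧ v ∉ S := fun v hv => hv.mem
  have hZ : ∀ v ∈ Z, v ∈ X' ∨ v ∈ S := fun v hv => by simpa using hv.mem
  have hC : R.outer ∉ C := fun h => by simpa using h.mem
  have hUb : ∀ v ∈ R.boundary.verts, v ∈ U ↔ v ∈ X := fun v hv =>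
    ⟨fun h => (hU v h).resolve_right fun h => h.1 hv, fun h => .base h⟩
  have hZb : ∀ v ∈ R.boundary.verts, v ∈ Z ↔ v ∈ X' := fun v hv =>
    ⟨fun h => (hZ v h).resolve_right fun h => Set.disjoint_left.1 hS h hv,
      fun h => .base ⟨v, h, rfl⟩⟩
  have hUZ : Disjoint U Z := by
    rw [Set.disjoint_left]
    intro v h1 h2
    rcases hU v h1 with h1 | h1 <;> rcases hZ v h2 with h2 | h2
    · exact Set.disjoint_left.1 hXX' h1 h2
    · exact Set.disjoint_left.1 hS h2 (hX h1)
    · exact h1.1 (hX' h2)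
    · exact h1.2 h2
  have hpar' : ∃! d, R.faceOf d = R.outer ∧
      (d.fst ∈ U ∧ d.snd ∈ Z ∨ d.fst ∈ Z ∧ d.snd ∈ U) := by
    refine (existsUnique_congr fun d => and_congr_right fun h => ?_).2 hpar
    rw [hUb _ (R.fst_mem_boundary h), hUb _ (R.snd_mem_boundary h),
      hZb _ (R.fst_mem_boundary h), hZb _ (R.snd_mem_boundary h)]
  -- An interior `w` would be absorbed into `Z` through `F` if `w ∈ S`, and into `U` through `u`
  -- otherwise. So `w` is on the boundary, and only `Y'` remains for it.
  have key : ∀ u w F, G.Adj u w → w ∈ R.faceVerts F → u ∈ U → w ∉ U → w ∉ Z → F ∈ C →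
      ∃ z, ∃ y ∈ Y', R.cone.ReachThrough (R.withCells S) (.inl '' X') z ∧
        R.cone.Adj z (.inl y) := by
    intro u w F huw hwF hu hwU hwZ hF
    by_cases hwb : w ∈ R.boundary.verts
    · rcases hcover hwb with ((h | h) | h) | h
      · exact (hwU (.base h)).elim
      · exact (hwZ (.base ⟨w, h, rfl⟩)).elim
      · exact (hcut u w hu h huw).elim
      · exact ⟨_, w, h, hF, hwF⟩
    · by_cases hwS : w ∈ S
      · exact (hwZ (ReachThrough.step hF (R.cone_adj_inr_inl.2 hwF) hwS)).elim
      · exact (hwU (ReachThrough.step hu huw ⟨hwb, hwS⟩)).elim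
  -- The first alternative cannot occur: the end of `d` in `Z` lies on its face, which puts the face
  -- in `C`.
  obtain ⟨d, hd, ⟨h, hF⟩ | ⟨h, hF⟩⟩ := R.exists_mixed_dart U Z C hC hpar' hUZ
  · refine (hF ?_).elim
    rcases h with h | h
    · exact ReachThrough.step h.2 (R.cone_adj_inl_inr.2 (R.snd_mem_faceVerts d)) hd
    · exact ReachThrough.step h.1 (R.cone_adj_inl_inr.2 (R.fst_mem_faceVerts d)) hd
  · rcases h with ⟨h1, h2, h3⟩ | ⟨h1, h2, h3⟩
    · exact key _ _ _ d.adj (R.snd_mem_faceVerts d) h1 h2 h3 hF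
    · exact key _ _ _ d.adj.symm (R.fst_mem_faceVerts d) h1 h2 h3 hF

/-- In a triangulation, any two vertices of a `2`-cell are adjacent. -/
theorem adj_of_mem_faceVerts {F : R.Face} (hF : (R.faceVerts F).ncard ≤ 3) {u v : V}
    (hu : u ∈ R.faceVerts F) (hv : v ∈ R.faceVerts F) (huv : u ≠ v) : G.Adj u v := by
  obtain ⟨d, rfl, rfl⟩ := hu
  have hinj : ∀ c c', R.faceOf c = R.faceOf d → R.faceOf c' = R.faceOf d → c.fst = c'.fst →
      c = c' := fun c c' h h' => R.face_embedded c c' (h.trans h'.symm)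
  have h1 := R.faceOf_next d
  have h2 := (R.faceOf_next (R.next d)).trans h1
  by_contra hadj
  have hne1 : v ≠ (R.next d).fst := by
    rintro rfl
    exact hadj (by rw [R.next_fst]; exact d.adj)
  -- Otherwise the face would be a cycle of two darts, with only two vertices.
  have hnd : (R.next (R.next d)).fst ≠ d.fst := fun h => by
    have h3 := hinj _ _ h2 rfl h
    have hsub : R.faceVerts (R.faceOf d) ⊆ {d.fst, (R.next d).fst} := by
      rintro w ⟨c, hc, rfl⟩
      obtain ⟨n, -, rfl⟩ := (R.faceOf_eq_iff.1 hc.symm).exists_pow_eq'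
      have : ∀ n : ℕ, (R.next ^ n) d = d ∨ (R.next ^ n) d = R.next d := by
        intro n
        induction n with
        | zero => exact .inl rfl
        | succ n ih =>
          rw [pow_succ', Equiv.Perm.mul_apply]
          rcases ih with h | h <;> rw [h]
          · exact .inr rfl
          · exact .inl h3
      rcases this n with h | h <;> simp [h]
    have := (R.three_le _).trans ((Set.ncard_le_ncard hsub).trans (Set.ncard_insert_le _ _))
    rw [Set.ncard_singleton] at this
    omega
  -- Otherwise `v`, not being adjacent to `d.fst`, differs from the tail of the dart `c` preceding
  -- `d`, and that tail is a fourth vertex of the face.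
  have hne2 : v ≠ (R.next (R.next d)).fst := by
    rintro rfl
    obtain ⟨c, hc⟩ := R.next.surjective d
    have hcF : R.faceOf c = R.faceOf d := by rw [← hc, R.faceOf_next]
    have hcd : c.snd = d.fst := by rw [← R.next_fst, hc]
    have hcv : c.fst ≠ (R.next (R.next d)).fst := fun h => hadj (by
      rw [← h, ← hcd]; exact c.adj.symm)
    have h4 : c.fst ≠ d.fst := fun h => c.adj.ne (h.trans hcd.symm)
    have h5 : c.fst ≠ (R.next d).fst := fun h => by
      have := hinj _ _ hcF h1 h
      rw [← this, hc] at hnd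
      exact hnd rfl
    have h6 : (R.next d).fst ≠ d.fst := by rw [R.next_fst]; exact d.adj.ne.symm
    have h7 : (R.next (R.next d)).fst ≠ (R.next d).fst := by
      rw [R.next_fst (R.next d)]; exact (R.next d).adj.ne.symm
    have hsub : ({c.fst, d.fst, (R.next d).fst, (R.next (R.next d)).fst} : Finset V) ⊆
        (R.faceVerts (R.faceOf d)).toFinset := by
      intro w hw
      simp only [Finset.mem_insert, Finset.mem_singleton] at hw
      rw [Set.mem_toFinset]
      rcases hw with rfl | rfl | rfl | rfl
      exacts [⟨_, hcF, rfl⟩, ⟨_, rfl, rfl⟩, ⟨_, h1, rfl⟩, ⟨_, h2, rfl⟩]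
    have := Finset.card_le_card hsub
    rw [Finset.card_insert_of_notMem (by simp [h4, h5, hcv]),
      Finset.card_insert_of_notMem (by simp [h6.symm, huv]),
      Finset.card_pair h7.symm, ← Set.ncard_eq_toFinset_card'] at this
    omega
  have hsub : ({v, d.fst, (R.next d).fst, (R.next (R.next d)).fst} : Finset V) ⊆
      (R.faceVerts (R.faceOf d)).toFinset := by
    intro w hw
    simp only [Finset.mem_insert, Finset.mem_singleton] at hw
    rw [Set.mem_toFinset]
    rcases hw with rfl | rfl | rfl | rfl
    exacts [hv, ⟨_, rfl, rfl⟩, ⟨_, h1, rfl⟩, ⟨_, h2, rfl⟩]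
  have h6 : (R.next d).fst ≠ d.fst := by rw [R.next_fst]; exact d.adj.ne.symm
  have h7 : (R.next (R.next d)).fst ≠ (R.next d).fst := by
    rw [R.next_fst (R.next d)]; exact (R.next d).adj.ne.symm
  have := Finset.card_le_card hsub
  rw [Finset.card_insert_of_notMem (by simp [hne1, hne2, huv.symm]),
    Finset.card_insert_of_notMem (by simp [h6.symm, hnd.symm]),
    Finset.card_pair h7.symm, ← Set.ncard_eq_toFinset_card'] at this
  omega

/-- In a triangulation, a path through vertices and `2`-cells can be replaced by a path through
the same vertices. -/
theorem ReachThrough.of_withCells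
    (h3 : ∀ F, F ≠ R.outer → (R.faceVerts F).ncard ≤ 3) {S X : Set V} {z : V ⊕ R.Face}
    (h : R.cone.ReachThrough (R.withCells S) (.inl '' X) z) :
    match z with
    | .inl v => G.ReachThrough S X v
    | .inr F => ∃ v ∈ R.faceVerts F, G.ReachThrough S X v := by
  induction h with
  | base hx =>
    obtain ⟨x, hx, rfl⟩ := hx
    exact .base hx
  | @step v w hv hvw hw ih =>
    rcases v with v | F <;> rcases w with w | F'
    · exact .step ih hvw hw
    · exact ⟨v, hvw, ih⟩
    · obtain ⟨v, hvF, hv'⟩ := ih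
      by_cases hvw' : v = w
      · exact hvw' ▸ hv'
      · refine .step hv' (R.adj_of_mem_faceVerts (h3 F ?_) hvF hvw hvw') hw
        rcases hv.mem with ⟨x, -, hx⟩ | h
        · cases hx
        · exact h
    · exact hvw.elim

end PolygonalSubdivision

/-! ### Complementary arcs, first of a cycle and then of the boundary. -/

namespace Equiv.Perm

variable {α : Type*} {σ : Equiv.Perm α} {x y z : α}

theorem Arc.ne_right (h : σ.Arc x y z) : z ≠ y := fun e => not_arc_right (e ▸ h)

theorem Arc.sameCycle (h : σ.Arc x y z) : σ.SameCycle x z := by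
  obtain ⟨i, hi, -⟩ := h
  exact ⟨i, by simpa using hi⟩

theorem Arc.not_arc_symm (h : σ.Arc x y z) : ¬ σ.Arc y x z := by
  obtain ⟨i, hi, h⟩ := h
  induction i generalizing z with
  | zero =>
    obtain rfl : x = z := hi
    exact not_arc_right
  | succ i ih =>
    rw [pow_succ', mul_apply] at hi
    intro h'
    rw [← hi] at h'
    refine ih rfl (fun j hj => h j (by omega)) (h'.of_apply ?_)
    have := h (i + 1) le_rfl
    rwa [pow_succ', mul_apply] at this

theorem arc_or_arc_symm [Finite α] (hxy : x ≠ y) (h : σ.SameCycle y z) :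
    σ.Arc x y z ∨ σ.Arc y x z := by
  rw [or_iff_not_imp_left]
  obtain ⟨n, -, rfl⟩ := h.exists_pow_eq'
  clear h
  induction n with
  | zero => exact fun _ => arc_self hxy.symm
  | succ n ih =>
    rw [pow_succ', mul_apply]
    intro h
    by_cases h1 : σ ((σ ^ n) y) = x
    · rw [h1] at h
      exact (h (arc_self hxy)).elim
    by_cases h2 : σ ((σ ^ n) y) = y
    · rw [h2]
      exact arc_self hxy.symm
    · exact (ih fun h' => h (h'.apply h2)).apply h1

theorem Arc.induction {P : α → Prop} (base : P (σ x))
    (step : ∀ z, σ.Arc x y z → z ≠ x → P z → σ.Arc x y (σ z) → P (σ z))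
    (h : σ.Arc x y z) (hz : z ≠ x) : P z := by
  obtain ⟨i, rfl, h⟩ := h
  induction i with
  | zero => exact (hz rfl).elim
  | succ i ih =>
    have hi : σ.Arc x y ((σ ^ i) x) := ⟨i, rfl, fun j hj => h j (by omega)⟩
    have hi' : σ.Arc x y (σ ((σ ^ i) x)) :=
      ⟨i + 1, by rw [pow_succ', mul_apply], h⟩
    rw [pow_succ', mul_apply]
    by_cases hx : (σ ^ i) x = x
    · rwa [hx]
    · exact step _ hi hx (ih (fun j hj => h j (by omega)) hx) hi'

end Equiv.Perm

namespace PolygonalSubdivision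

open SimpleGraph RotationSystem Equiv.Perm VertexWidth

variable {V : Type*} [Fintype V] {G : SimpleGraph V} (R : PolygonalSubdivision G)

/-- The vertices strictly inside the arc of the boundary that leads from the tail of `x` to the
tail of `y`. -/
def arcVerts (x y : G.Dart) : Set V := {v | ∃ d, R.next.Arc x y d ∧ d ≠ x ∧ d.fst = v}

variable {R} {x y d d' : G.Dart}

theorem faceOf_of_arc (hx : R.faceOf x = R.outer) (h : R.next.Arc x y d) :
    R.faceOf d = R.outer := by
  rw [← hx, eq_comm]
  exact R.faceOf_eq_iff.2 h.sameCycle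

theorem fst_ne_of_ne (hd : R.faceOf d = R.outer) (hd' : R.faceOf d' = R.outer) (h : d ≠ d') :
    d.fst ≠ d'.fst := fun h' => h (R.face_embedded _ _ (hd.trans hd'.symm) h')

theorem fst_mem_arcVerts_iff (hx : R.faceOf x = R.outer) (hd : R.faceOf d = R.outer) :
    d.fst ∈ R.arcVerts x y ↔ R.next.Arc x y d ∧ d ≠ x := by
  refine ⟨?_, fun h => ⟨d, h.1, h.2, rfl⟩⟩
  rintro ⟨d', h, h', hd'⟩
  rw [← R.face_embedded _ _ ((faceOf_of_arc hx h).trans hd.symm) hd']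
  exact ⟨h, h'⟩

theorem arcVerts_subset (hx : R.faceOf x = R.outer) : R.arcVerts x y ⊆ R.boundary.verts := by
  rintro _ ⟨d, h, -, rfl⟩
  exact R.fst_mem_boundary (faceOf_of_arc hx h)

theorem left_notMem_arcVerts (hx : R.faceOf x = R.outer) : x.fst ∉ R.arcVerts x y := by
  rw [fst_mem_arcVerts_iff hx hx]
  exact fun h => h.2 rfl

theorem right_notMem_arcVerts (hx : R.faceOf x = R.outer) (hy : R.faceOf y = R.outer) :
    y.fst ∉ R.arcVerts x y := by
  rw [fst_mem_arcVerts_iff hx hy]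
  exact fun h => h.1.ne_right rfl

theorem boundary_subset (hy : R.faceOf y = R.outer) (hxy : x ≠ y) :
    R.boundary.verts ⊆ {x.fst} ∪ R.arcVerts x y ∪ {y.fst} ∪ R.arcVerts y x := by
  rintro _ ⟨d, hd, rfl⟩
  by_cases h1 : d = x
  · simp [h1]
  by_cases h2 : d = y
  · simp [h2]
  rcases arc_or_arc_symm hxy (R.faceOf_eq_iff.1 (hy.trans hd.symm)) with h | h
  · exact .inl (.inl (.inr ⟨d, h, h1, rfl⟩))
  · exact .inr ⟨d, h, h2, rfl⟩

theorem disjoint_arcVerts (hx : R.faceOf x = R.outer) (hy : R.faceOf y = R.outer) :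
    Disjoint (R.arcVerts x y) (R.arcVerts y x) := by
  rw [Set.disjoint_left]
  rintro _ ⟨d, h, -, rfl⟩ h'
  exact h.not_arc_symm ((fst_mem_arcVerts_iff hy (faceOf_of_arc hx h)).1 h').1

theorem boundary_adj_iff {u v : V} : R.boundary.Adj u v ↔
    ∃ d, R.faceOf d = R.outer ∧ (d.fst = u ∧ d.snd = v ∨ d.fst = v ∧ d.snd = u) := by
  refine exists_congr fun d => and_congr_right fun _ => ?_
  rw [SimpleGraph.dart_edge_eq_mk'_iff']

/-- A dart of the outer face issuing from one open arc ends in the same arc or at its terminal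
point. -/
theorem not_boundary_adj_arcVerts (hx : R.faceOf x = R.outer) (hy : R.faceOf y = R.outer)
    {u v : V} (hu : u ∈ R.arcVerts x y) (hv : v ∈ R.arcVerts y x) : ¬ R.boundary.Adj u v := by
  have key : ∀ {x y d : G.Dart}, R.faceOf x = R.outer → R.faceOf y = R.outer →
      R.faceOf d = R.outer → d.fst ∈ R.arcVerts x y → d.snd ∈ R.arcVerts y x → False := by
    intro x y d hx hy hd h1 h2
    rw [← R.next_fst, fst_mem_arcVerts_iff hy ((R.faceOf_next d).trans hd)] at h2
    rw [fst_mem_arcVerts_iff hx hd] at h1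
    exact h2.1.not_arc_symm (h1.1.apply h2.2)
  rw [boundary_adj_iff]
  rintro ⟨d, hd, ⟨rfl, rfl⟩ | ⟨rfl, rfl⟩⟩
  · exact key hx hy hd hu hv
  · exact key hy hx hd hv hu

/-- This is the odd boundary count needed for Sperner's lemma. Non-adjacency makes the arc after `x`
non-empty, so `x` itself is such a dart; the dart that enters the tail of `x` comes from outside
this arc. -/
theorem existsUnique_dart_arcVerts (hx : R.faceOf x = R.outer) (hy : R.faceOf y = R.outer)
    (hxy : x ≠ y) (hadj : ¬ R.boundary.Adj x.fst y.fst) :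
    ∃! d, R.faceOf d = R.outer ∧ (d.fst ∈ ({x.fst} : Set V) ∧ d.snd ∈ R.arcVerts x y ∨
      d.fst ∈ R.arcVerts x y ∧ d.snd ∈ ({x.fst} : Set V)) := by
  have hne : R.next x ≠ y := fun h => hadj (boundary_adj_iff.2 ⟨x, hx, .inl ⟨rfl, by
    rw [← h, R.next_fst]⟩⟩)
  refine ⟨x, ⟨hx, .inl ⟨rfl, ?_⟩⟩, ?_⟩
  · rw [← R.next_fst, fst_mem_arcVerts_iff hx ((R.faceOf_next x).trans hx)]
    exact ⟨(arc_self hxy).apply hne, R.next_ne x⟩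
  · rintro d ⟨hd, ⟨h, -⟩ | ⟨h1, h2⟩⟩
    · exact R.face_embedded _ _ (hd.trans hx.symm) h
    · rw [fst_mem_arcVerts_iff hx hd] at h1
      have h3 : R.next d = x :=
        R.face_embedded _ _ ((R.faceOf_next d).trans (hd.trans hx.symm)) ((R.next_fst d).trans h2)
      exact (not_arc_of_apply_eq_left (R.faceOf_eq_iff.1 (hx.trans hy.symm)) h3 h1.1).elim

theorem reachable_of_arc (hx : R.faceOf x = R.outer) {T : Set V}
    (hT : ∀ d, R.faceOf d = R.outer → d ≠ x → d ≠ y → d.fst ∉ T)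
    (hd : R.next.Arc x y d) (hdx : d ≠ x) (h : d.fst ∈ (R.boundary.deleteVerts T).verts) :
    ∃ h', (R.boundary.deleteVerts T).coe.Reachable ⟨(R.next x).fst, h'⟩ ⟨d.fst, h⟩ := by
  revert h
  refine Arc.induction (P := fun d => ∀ h : d.fst ∈ (R.boundary.deleteVerts T).verts,
    ∃ h', (R.boundary.deleteVerts T).coe.Reachable ⟨(R.next x).fst, h'⟩ ⟨d.fst, h⟩)
    (fun h => ⟨h, .refl _⟩) (fun z hz hzx ih hz' h => ?_) hd hdx
  have hzo := faceOf_of_arc hx hz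
  have hzT : z.fst ∉ T := hT z hzo hzx hz.ne_right
  obtain ⟨h', hr⟩ := ih ⟨R.fst_mem_boundary hzo, hzT⟩
  refine ⟨h', hr.trans (Adj.reachable ?_)⟩
  rw [Subgraph.coe_adj, Subgraph.deleteVerts_adj]
  exact ⟨R.fst_mem_boundary hzo, hzT, h.1, h.2, boundary_adj_iff.2 ⟨z, hzo, .inl ⟨rfl,
    (R.next_fst z).symm⟩⟩⟩

theorem not_arc_iff_of_not_reachable (hx : R.faceOf x = R.outer) (hy : R.faceOf y = R.outer)
    (hxy : x ≠ y) (hd : R.faceOf d = R.outer) (hd' : R.faceOf d' = R.outer)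
    (h : d.fst ∈ (R.boundary.deleteVerts {x.fst, y.fst}).verts)
    (h' : d'.fst ∈ (R.boundary.deleteVerts {x.fst, y.fst}).verts)
    (hr : ¬ (R.boundary.deleteVerts {x.fst, y.fst}).coe.Reachable ⟨d.fst, h⟩ ⟨d'.fst, h'⟩) :
    ¬ (R.next.Arc x y d ↔ R.next.Arc x y d') := by
  have hT : ∀ d, R.faceOf d = R.outer → d ≠ x → d ≠ y → d.fst ∉ ({x.fst, y.fst} : Set V) := by
    rintro d hd h1 h2 (h | h)
    exacts [fst_ne_of_ne hd hx h1 h, fst_ne_of_ne hd hy h2 h]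
  have hne : ∀ d : G.Dart, d.fst ∈ (R.boundary.deleteVerts {x.fst, y.fst}).verts →
      d ≠ x ∧ d ≠ y := by
    intro d h
    constructor <;> rintro rfl <;> exact h.2 (by simp)
  intro hiff
  by_cases hdd : R.next.Arc x y d
  · obtain ⟨_, h1⟩ := reachable_of_arc hx hT hdd (hne d h).1 h
    obtain ⟨_, h2⟩ := reachable_of_arc hx hT (hiff.1 hdd) (hne d' h').1 h'
    exact hr (h1.symm.trans h2)
  · have hdd' := hiff.not.1 hdd
    replace hT : ∀ d, R.faceOf d = R.outer → d ≠ y → d ≠ x →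
      d.fst ∉ ({x.fst, y.fst} : Set V) := fun d hd h1 h2 => hT d hd h2 h1
    have a1 := (arc_or_arc_symm hxy (R.faceOf_eq_iff.1 (hy.trans hd.symm))).resolve_left hdd
    have a2 := (arc_or_arc_symm hxy (R.faceOf_eq_iff.1 (hy.trans hd'.symm))).resolve_left hdd'
    obtain ⟨_, h1⟩ := reachable_of_arc hy hT a1 (hne d h).2 h
    obtain ⟨_, h2⟩ := reachable_of_arc hy hT a2 (hne d' h').2 h'
    exact hr (h1.symm.trans h2)

theorem not_reachable_of_arcVerts (hx : R.faceOf x = R.outer) (hy : R.faceOf y = R.outer)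
    (hxy : x ≠ y) {u v : V} (hu : u ∈ R.arcVerts x y) (hv : v ∈ R.arcVerts y x) :
    ∃ (h : u ∈ (R.boundary.deleteVerts {x.fst, y.fst}).verts)
      (h' : v ∈ (R.boundary.deleteVerts {x.fst, y.fst}).verts),
      ¬ (R.boundary.deleteVerts {x.fst, y.fst}).coe.Reachable ⟨u, h⟩ ⟨v, h'⟩ := by
  refine ⟨⟨arcVerts_subset hx hu, ?_⟩, ⟨arcVerts_subset hy hv, ?_⟩, ?_⟩
  · rintro (rfl | rfl)
    exacts [left_notMem_arcVerts hx hu, right_notMem_arcVerts hx hy hu]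
  · rintro (rfl | rfl)
    exacts [right_notMem_arcVerts hy hx hv, left_notMem_arcVerts hy hv]
  · rintro ⟨w⟩
    have key : ∀ {p q : (R.boundary.deleteVerts {x.fst, y.fst}).verts},
        (R.boundary.deleteVerts {x.fst, y.fst}).coe.Walk p q → (p : V) ∈ R.arcVerts x y →
        (q : V) ∈ R.arcVerts x y := by
      intro p q w hp
      induction w with
      | nil => exact hp
      | @cons p q r h w ih =>
        refine ih ?_
        rw [Subgraph.coe_adj, Subgraph.deleteVerts_adj] at h
        obtain ⟨-, -, h1, h2, h3⟩ := h
        rcases boundary_subset hy hxy h1 with ((h4 | h4) | h4) | h4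
        · exact (h2 (.inl h4)).elim
        · exact h4
        · exact (h2 (.inr h4)).elim
        · exact (not_boundary_adj_arcVerts hx hy hp h4 h3).elim
    exact Set.disjoint_left.1 (disjoint_arcVerts hx hy) (key w hu) hv

/-- A boundary edge on the path would have both ends on the boundary, hence would join `u` to `v`;
this is where their non-adjacency enters. -/
theorem isProper_of_isPath {u v : V} (hu : u ∈ R.boundary.verts) (hv : v ∈ R.boundary.verts)
    (huv : ¬ R.boundary.Adj u v) (p : G.Walk u v) (hp : p.IsPath)
    (hs : ∀ w ∈ p.support, w = u ∨ w = v ∨ w ∉ R.boundary.verts) : R.IsProper p := by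
  refine ⟨hu, hv, fun i h0 hi => ?_, fun e he => ?_⟩
  · rcases hs _ (p.getVert_mem_support i) with h | h | h
    · exact absurd (hp.getVert_injOn (show i ≤ p.length from hi.le) (Nat.zero_le _)
        (h.trans p.getVert_zero.symm)) (by omega)
    · exact absurd (hp.getVert_injOn (show i ≤ p.length from hi.le) (le_refl p.length)
        (h.trans p.getVert_length.symm)) (by omega)
    · exact h
  · induction e with | _ s t =>
    intro hst
    rw [Subgraph.mem_edgeSet] at hst
    have h1 := hs s (p.fst_mem_support_of_mem_edges he)
    have h2 := hs t (p.snd_mem_support_of_mem_edges he)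
    have h3 := R.boundary.edge_vert hst
    have h4 := R.boundary.edge_vert hst.symm
    rcases h1 with rfl | rfl | h1
    · rcases h2 with rfl | rfl | h2
      · exact hst.ne rfl
      · exact huv hst
      · exact h2 h4
    · rcases h2 with rfl | rfl | h2
      · exact huv hst.symm
      · exact hst.ne rfl
      · exact h2 h4
    · exact h1 h3

theorem IsProper.mem_support {u v w : V} {p : G.Walk u v} (hp : R.IsProper p)
    (hw : w ∈ p.support) : w = u ∨ w = v ∨ w ∉ R.boundary.verts := by
  obtain ⟨i, rfl, hi⟩ := (p.mem_support_iff_exists_getVert).1 hw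
  rcases Nat.eq_zero_or_pos i with rfl | h0
  · exact .inl p.getVert_zero
  rcases hi.eq_or_lt with rfl | hi
  · exact .inr (.inl p.getVert_length)
  · exact .inr (.inr (hp.2.2.1 i h0 hi))

end PolygonalSubdivision

/-! ### Level sets of the distance and a discrete coarea inequality. -/

namespace SimpleGraph

open scoped Classical
open MeasureTheory Set

variable {W : Type*} (H : SimpleGraph W)

/-- The costs at which a vertex can be reached from `X` along paths through `I`, where entering a
vertex `w` costs `μ w`. -/
inductive ReachCost (I X : Set W) (μ : W → ℝ≥0) : W → ℝ≥0 → Prop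
  | base {x : W} (hx : x ∈ X) : ReachCost I X μ x 0
  | step {v w : W} {c : ℝ≥0} (hv : ReachCost I X μ v c) (h : H.Adj v w) (hw : w ∈ I) :
      ReachCost I X μ w (c + μ w)

/-- The distance from `X` along paths through `I` for the vertex metric `μ`. -/
noncomputable def reachDist (I X : Set W) (μ : W → ℝ≥0) (w : W) : ℝ≥0∞ :=
  ⨅ c : {c : ℝ≥0 // H.ReachCost I X μ w c}, (c : ℝ≥0∞)

variable {H} {I X : Set W} {μ : W → ℝ≥0}

theorem ReachCost.exists_walk (hμ : ∀ x ∈ X, μ x = 0) {v : W} {c : ℝ≥0}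
    (h : H.ReachCost I X μ v c) : ∃ x ∈ X, ∃ p : H.Walk x v,
      (∀ u ∈ p.support, u = x ∨ u ∈ I) ∧ (p.support.map μ).sum = c := by
  induction h with
  | @base x hx => exact ⟨x, hx, .nil, by simp, by simp [hμ x hx]⟩
  | @step v w c _ h hw ih =>
    obtain ⟨x, hx, p, hp, hc⟩ := ih
    refine ⟨x, hx, p.concat h, fun u hu => ?_, ?_⟩
    · rw [Walk.support_concat, List.mem_append, List.mem_singleton] at hu
      rcases hu with hu | rfl
      · exact hp u hu
      · exact .inr hw
    · rw [Walk.support_concat, List.map_append, List.sum_append, hc]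
      simp

theorem reachDist_eq_zero {x : W} (hx : x ∈ X) : H.reachDist I X μ x = 0 :=
  le_antisymm (iInf_le (fun c : {c : ℝ≥0 // H.ReachCost I X μ x c} => (c : ℝ≥0∞)) ⟨0, .base hx⟩)
    zero_le

theorem reachDist_le {v w : W} (h : H.Adj v w) (hw : w ∈ I) :
    H.reachDist I X μ w ≤ H.reachDist I X μ v + μ w := by
  rw [reachDist, reachDist, ENNReal.iInf_add]
  refine le_iInf fun c => ?_
  exact iInf_le_of_le ⟨_, c.2.step h hw⟩ (by simp)

/-- The last step into `Y` costs nothing, so a neighbour of `Y` is already at the full distance. -/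
theorem one_le_reachDist {Y : Set W} (hμX : ∀ x ∈ X, μ x = 0) (hμY : ∀ y ∈ Y, μ y = 0)
    (hμ : ∀ x ∈ X, ∀ y ∈ Y, ∀ p : H.Walk x y, (∀ u ∈ p.support, u = x ∨ u = y ∨ u ∈ I) →
      1 ≤ (p.support.map μ).sum) {v y : W} (hy : y ∈ Y) (h : H.Adj v y) :
    1 ≤ H.reachDist I X μ v := by
  refine le_iInf fun ⟨c, hc⟩ => ?_
  obtain ⟨x, hx, p, hp, rfl⟩ := hc.exists_walk hμX
  have := hμ x hx y hy (p.concat h) fun u hu => by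
    rw [Walk.support_concat, List.mem_append, List.mem_singleton] at hu
    rcases hu with hu | rfl
    · exact (hp u hu).imp_right .inr
    · exact .inr (.inl rfl)
  rw [Walk.support_concat, List.map_append, List.sum_append] at this
  simp only [List.map_cons, List.map_nil, List.sum_cons, hμY y hy, List.sum_nil, add_zero] at this
  exact_mod_cast this

variable [Fintype W]

variable (H I X μ) in
/-- The vertices of `I` at which the distance from `X` crosses the level `t`. -/
noncomputable def levelSet (t : ℝ) : Finset W :=
  Finset.univ.filter fun v => v ∈ I ∧ ENNReal.ofReal t ≤ H.reachDist I X μ v ∧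
    H.reachDist I X μ v < ENNReal.ofReal t + μ v

theorem mem_levelSet {t : ℝ} {v : W} : v ∈ H.levelSet I X μ t ↔
    v ∈ I ∧ ENNReal.ofReal t ≤ H.reachDist I X μ v ∧
      H.reachDist I X μ v < ENNReal.ofReal t + μ v := by
  simp [levelSet]

/-- Entering `w` raises the distance by at most `μ w`, so a walk cannot pass from below `t` to `t`
or above without visiting the level set. A neighbour of `Y` is at distance at least `1 ≥ t`. -/
theorem levelSet_separates {Y : Set W} (hμX : ∀ x ∈ X, μ x = 0) (hμY : ∀ y ∈ Y, μ y = 0)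
    (hμ : ∀ x ∈ X, ∀ y ∈ Y, ∀ p : H.Walk x y, (∀ u ∈ p.support, u = x ∨ u = y ∨ u ∈ I) →
      1 ≤ (p.support.map μ).sum) {t : ℝ} (ht : t ∈ Ioc 0 1) {u y : W}
    (hu : H.ReachThrough (I \ H.levelSet I X μ t) X u) (hy : y ∈ Y) : ¬ H.Adj u y := by
  intro h
  have h1 := one_le_reachDist hμX hμY hμ hy h
  have key : H.reachDist I X μ u < ENNReal.ofReal t := by
    clear h h1
    induction hu with
    | base hx =>
      rw [reachDist_eq_zero hx]
      exact ENNReal.ofReal_pos.2 ht.1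
    | @step v w _ h hw ih =>
      by_contra! hle
      refine hw.2 (mem_levelSet.2 ⟨hw.1, hle, (reachDist_le h hw.1).trans_lt ?_⟩)
      exact ENNReal.add_lt_add_right ENNReal.coe_ne_top ih
  exact absurd (h1.trans_lt (key.trans_le (ENNReal.ofReal_le_one.2 ht.2))) (lt_irrefl _)

theorem measurableSet_mem_levelSet (v : W) : MeasurableSet {t | v ∈ H.levelSet I X μ t} := by
  simp only [mem_levelSet]
  refine (MeasurableSet.const _).inter (MeasurableSet.inter ?_ ?_)
  · exact measurableSet_le ENNReal.measurable_ofReal measurable_const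
  · exact measurableSet_lt measurable_const (ENNReal.measurable_ofReal.add_const _)

theorem measurableSet_levelSet_eq (A : Finset W) :
    MeasurableSet (H.levelSet I X μ ⁻¹' {A}) := by
  have : H.levelSet I X μ ⁻¹' {A} = ⋂ v, {t | v ∈ H.levelSet I X μ t ↔ v ∈ A} := by
    ext t
    simp [Finset.ext_iff]
  rw [this]
  refine MeasurableSet.iInter fun v => ?_
  by_cases hv : v ∈ A
  · simpa only [hv, iff_true] using measurableSet_mem_levelSet v
  · simp only [hv, iff_false]
    exact (measurableSet_mem_levelSet v).compl

/-- The levels `t` concerned lie in `(d - μ v, d]`, where `d` is the distance of `v`; there are none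
when `d` is infinite. -/
theorem volume_mem_levelSet_le (v : W) :
    (volume.restrict (Ioc (0 : ℝ) 1)).real {t | v ∈ H.levelSet I X μ t} ≤ μ v := by
  rw [measureReal_restrict_apply (measurableSet_mem_levelSet v)]
  by_cases hd : H.reachDist I X μ v = ⊤
  · have : {t | v ∈ H.levelSet I X μ t} = ∅ := by
      ext t
      simp [mem_levelSet, hd]
    simp [this]
  · obtain ⟨d, hd'⟩ : ∃ d : ℝ≥0, (d : ℝ≥0∞) = H.reachDist I X μ v :=
      ⟨_, ENNReal.coe_toNNReal hd⟩
    have hsub : {t | v ∈ H.levelSet I X μ t} ∩ Ioc (0 : ℝ) 1 ⊆ Ioc ((d : ℝ) - μ v) d := by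
      rintro t ⟨ht, ht0⟩
      obtain ⟨-, h1, h2⟩ := mem_levelSet.1 ht
      rw [← hd'] at h1 h2
      rw [ENNReal.ofReal, ENNReal.coe_le_coe, ← NNReal.coe_le_coe, Real.coe_toNNReal _ ht0.1.le]
        at h1
      rw [ENNReal.ofReal, ← ENNReal.coe_add, ENNReal.coe_lt_coe, ← NNReal.coe_lt_coe,
        NNReal.coe_add, Real.coe_toNNReal _ ht0.1.le] at h2
      exact ⟨by linarith, h1⟩
    refine (measureReal_mono hsub (by simp)).trans ?_
    rw [Real.volume_real_Ioc]
    simp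

/-- A vertex metric that is admissible for the paths from `X` to `Y` through `I` dominates a
convex combination of indicators of sets that separate `X` from `Y`. -/
theorem exists_weights_of_admissible {Y : Set W} (hμX : ∀ x ∈ X, μ x = 0)
    (hμY : ∀ y ∈ Y, μ y = 0)
    (hμ : ∀ x ∈ X, ∀ y ∈ Y, ∀ p : H.Walk x y, (∀ u ∈ p.support, u = x ∨ u = y ∨ u ∈ I) →
      1 ≤ (p.support.map μ).sum) :
    ∃ p : Finset W → ℝ, (∀ A, 0 ≤ p A) ∧ ∑ A, p A = 1 ∧
      (∀ A, p A ≠ 0 → (A : Set W) ⊆ I ∧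
        ∀ u y, H.ReachThrough (I \ A) X u → y ∈ Y → ¬ H.Adj u y) ∧
      ∀ v, ∑ A, (if v ∈ A then p A else 0) ≤ μ v := by
  -- The weight of `A` is the probability that the level set at a uniformly random level in `(0, 1]`
  -- equals `A`.
  refine ⟨fun A => (volume.restrict (Ioc (0 : ℝ) 1)).real (H.levelSet I X μ ⁻¹' {A}),
    fun A => measureReal_nonneg, ?_, fun A hA => ?_, fun v => ?_⟩
  · rw [sum_measureReal_preimage_singleton _ fun A _ => measurableSet_levelSet_eq A]
    simp
  · obtain ⟨t, ht, ht'⟩ : ∃ t ∈ Ioc (0 : ℝ) 1, H.levelSet I X μ t = A := by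
      by_contra! hcon
      refine hA ?_
      beta_reduce
      rw [measureReal_restrict_apply (measurableSet_levelSet_eq A)]
      have : H.levelSet I X μ ⁻¹' {A} ∩ Ioc (0 : ℝ) 1 = ∅ := by
        ext t
        simp only [mem_inter_iff, mem_preimage, mem_singleton_iff, mem_empty_iff_false, iff_false,
          not_and]
        exact fun h h' => hcon t h' h
      rw [this, measureReal_empty]
    subst ht'
    refine ⟨fun v hv => (mem_levelSet.1 hv).1, fun u y hu hy => ?_⟩
    exact levelSet_separates hμX hμY hμ ht hu hy
  · refine le_trans (le_of_eq ?_) (volume_mem_levelSet_le (H := H) (I := I) (X := X) v)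
    rw [← Finset.sum_filter,
      sum_measureReal_preimage_singleton _ fun A _ => measurableSet_levelSet_eq A]
    congr 1
    ext t
    simp

end SimpleGraph

/-! ### Extremal metrics and products of extremal widths. -/

namespace VertexWidth

open scoped Classical

variable {V : Type*} {G : SimpleGraph V}

theorem coe_length (μ : V → ℝ≥0) (γ : GraphPath G) :
    (length μ γ : ℝ) = (γ.2.2.support.map fun v => (μ v : ℝ)).sum := by
  rw [length, NNReal.coe_list_sum, List.map_map]
  rfl

theorem sum_toFinset_le {f : V → ℝ} (hf : ∀ v, 0 ≤ f v) (l : List V) :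
    ∑ v ∈ l.toFinset, f v ≤ (l.map f).sum := by
  rw [Finset.sum_list_map_count]
  refine Finset.sum_le_sum fun v hv => ?_
  rw [nsmul_eq_mul]
  refine le_mul_of_one_le_left (hf v) ?_
  exact_mod_cast List.count_pos_iff.2 (List.mem_toFinset.1 hv)

theorem sum_map_linear (l : List V) (a b : ℝ) (f g : V → ℝ) :
    (l.map fun v => a * f v + b * g v).sum = a * (l.map f).sum + b * (l.map g).sum := by
  rw [List.sum_map_add, List.sum_map_mul_left, List.sum_map_mul_left]

/-- The vertex metrics that are admissible for `Γ` relative to `W`, as points of a Euclidean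
space. -/
def admissibleSet (Γ : Set (GraphPath G)) (W : Set V) : Set (EuclideanSpace ℝ V) :=
  {f | (∀ v, 0 ≤ f v) ∧ (∀ v ∈ W, f v = 0) ∧ ∀ γ ∈ Γ, 1 ≤ (γ.2.2.support.map fun v => f v).sum}

variable (Γ Γ' : Set (GraphPath G)) (W : Set V)

theorem convex_admissibleSet : Convex ℝ (admissibleSet Γ W) := by
  rintro f ⟨h1, h2, h3⟩ g ⟨h4, h5, h6⟩ a b ha hb hab
  refine ⟨fun v => ?_, fun v hv => ?_, fun γ hγ => ?_⟩
  · have := h1 v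
    have := h4 v
    simp only [PiLp.add_apply, PiLp.smul_apply, smul_eq_mul]
    positivity
  · simp [h2 v hv, h5 v hv]
  · simp only [PiLp.add_apply, PiLp.smul_apply, smul_eq_mul]
    rw [sum_map_linear]
    nlinarith [h3 γ hγ, h6 γ hγ]

theorem isClosed_admissibleSet : IsClosed (admissibleSet Γ W) := by
  simp only [admissibleSet, Set.ofPred_and, Set.ofPred_forall]
  refine (isClosed_iInter fun v => ?_).inter
    ((isClosed_biInter fun v _ => ?_).inter (isClosed_biInter fun γ _ => ?_))
  · exact isClosed_le continuous_const (by fun_prop)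
  · exact isClosed_eq (by fun_prop) continuous_const
  · exact isClosed_le continuous_const (continuous_list_sum _ fun v _ => by fun_prop)

variable {Γ Γ' W}

theorem one_le_sum_of_mem {f : V → ℝ} (hf : ∀ v, 0 ≤ f v) {l : List V} {v : V} (hv : v ∈ l)
    (h : 1 ≤ f v) : 1 ≤ (l.map f).sum :=
  h.trans (List.single_le_sum (by simpa using fun a _ => hf a) _ (List.mem_map_of_mem hv))

variable [Fintype V]

/-- If any two paths of `Γ` and `Γ'` meet outside `W`, then a suitable multiple of the metric of
least area among those admissible for `Γ` is admissible for `Γ'`. -/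
theorem exists_admissible_pair (hΓ : Γ.Nonempty) (hΓ' : Γ'.Nonempty)
    (h : ∀ γ ∈ Γ, ∀ γ' ∈ Γ', ∃ z ∈ γ.2.2.support, z ∈ γ'.2.2.support ∧ z ∉ W) :
    ∃ μ ν : V → ℝ≥0, Admissible Γ W μ ∧ Admissible Γ' W ν ∧ area μ * area ν = 1 := by
  -- The indicator of `γ'` off `W` is admissible for `Γ`, because every path of `Γ` meets `γ'` off
  -- `W`.
  let m : GraphPath G → EuclideanSpace ℝ V := fun γ' =>
    WithLp.toLp 2 fun v => if v ∈ γ'.2.2.support ∧ v ∉ W then 1 else 0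
  have hm : ∀ γ' ∈ Γ', m γ' ∈ admissibleSet Γ W := by
    intro γ' hγ'
    have h0 : ∀ v, 0 ≤ m γ' v := fun v => by
      simp only [m]
      split_ifs <;> simp
    refine ⟨h0, fun v hv => by simp [m, hv], fun γ hγ => ?_⟩
    obtain ⟨z, hz, hz', hzW⟩ := h γ hγ γ' hγ'
    exact one_le_sum_of_mem h0 hz (by simp [m, hz', hzW])
  obtain ⟨γ₀', hγ₀'⟩ := hΓ'
  obtain ⟨f, hf, hmin⟩ := exists_norm_eq_iInf_of_complete_convex ⟨_, hm γ₀' hγ₀'⟩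
    (isClosed_admissibleSet Γ W).isComplete (convex_admissibleSet Γ W) 0
  rw [norm_eq_iInf_iff_real_inner_le_zero (convex_admissibleSet Γ W) hf] at hmin
  set M : ℝ := ∑ v, f v ^ 2 with hM
  -- The point `f` is the projection of the origin to a closed convex set; this is its variational
  -- inequality.
  have hvar : ∀ g ∈ admissibleSet Γ W, M ≤ ∑ v, f v * g v := by
    intro g hg
    have := hmin g hg
    rw [zero_sub, inner_neg_left, inner_sub_right, PiLp.inner_apply, PiLp.inner_apply] at this
    simp only [RCLike.inner_apply, conj_trivial] at this
    have e1 : ∑ v, f v * f v = M := Finset.sum_congr rfl fun v _ => (sq _).symm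
    have e2 : ∑ v, g v * f v = ∑ v, f v * g v := Finset.sum_congr rfl fun v _ => mul_comm _ _
    linarith
  have hMpos : 0 < M := by
    obtain ⟨γ, hγ⟩ := hΓ
    by_contra! hle
    have h0 : ∀ v, f v = 0 := by
      have := (Finset.sum_eq_zero_iff_of_nonneg (fun v _ => sq_nonneg (f v))).1
        (le_antisymm hle (Finset.sum_nonneg fun v _ => sq_nonneg (f v)))
      exact fun v => by simpa using this v (Finset.mem_univ v)
    have := hf.2.2 γ hγ
    simp only [h0] at this
    norm_num at this
  have hco : ∀ v, ((f v).toNNReal : ℝ) = f v := fun v => Real.coe_toNNReal _ (hf.1 v)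
  have hMc : (M.toNNReal : ℝ) = M := Real.coe_toNNReal _ hMpos.le
  refine ⟨fun v => (f v).toNNReal, fun v => (f v).toNNReal / M.toNNReal,
    ⟨fun γ hγ => ?_, fun v hv => by simp [hf.2.1 v hv]⟩,
    ⟨fun γ' hγ' => ?_, fun v hv => by simp [hf.2.1 v hv]⟩, ?_⟩
  · rw [← NNReal.coe_le_coe, coe_length]
    simpa only [hco, NNReal.coe_one] using hf.2.2 γ hγ
  · rw [← NNReal.coe_le_coe, coe_length]
    simp only [NNReal.coe_mul, NNReal.coe_inv, hco, hMc, NNReal.coe_one, div_eq_mul_inv]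
    rw [List.sum_map_mul_right, ← div_eq_mul_inv, one_le_div hMpos]
    refine (hvar _ (hm γ' hγ')).trans (le_trans ?_ (sum_toFinset_le hf.1 _))
    simp only [m, mul_ite, mul_one, mul_zero]
    rw [← Finset.sum_filter]
    refine Finset.sum_le_sum_of_subset_of_nonneg (fun v hv => ?_) fun v _ _ => hf.1 v
    exact List.mem_toFinset.2 (Finset.mem_filter.1 hv).2.1
  · rw [← NNReal.coe_inj]
    simp only [area, NNReal.coe_mul, NNReal.coe_sum, NNReal.coe_pow, NNReal.coe_div, hco, hMc,
      div_pow, NNReal.coe_one]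
    rw [← Finset.sum_div, ← hM]
    field_simp

theorem EW_mul_EW_le_one (hΓ : Γ.Nonempty) (hΓ' : Γ'.Nonempty)
    (h : ∀ γ ∈ Γ, ∀ γ' ∈ Γ', ∃ z ∈ γ.2.2.support, z ∈ γ'.2.2.support ∧ z ∉ W) :
    EW Γ W * EW Γ' W ≤ 1 := by
  obtain ⟨μ, ν, hμ, hν, hμν⟩ := exists_admissible_pair hΓ hΓ' h
  calc EW Γ W * EW Γ' W ≤ area μ * area ν :=
        mul_le_mul' (iInf₂_le μ hμ) (iInf₂_le ν hν)
    _ = 1 := by exact_mod_cast congrArg ((↑) : ℝ≥0 → ℝ≥0∞) hμν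

theorem le_EW_mul_EW {c : ℝ≥0∞} (hc : c ≠ ⊤)
    (h : ∀ μ ν, Admissible Γ W μ → Admissible Γ' W ν → c ≤ area μ * area ν)
    (hΓ : Γ.Nonempty) (hΓ' : Γ'.Nonempty)
    (hmeet : ∀ γ ∈ Γ, ∀ γ' ∈ Γ', ∃ z ∈ γ.2.2.support, z ∈ γ'.2.2.support ∧ z ∉ W) :
    c ≤ EW Γ W * EW Γ' W := by
  rcases eq_or_ne c 0 with rfl | hc0
  · exact zero_le
  obtain ⟨μ₀, ν₀, hμ₀, hν₀, -⟩ := exists_admissible_pair hΓ hΓ' hmeet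
  -- Finiteness here, and positivity below, allow division by `EW Γ W` and exclude the degenerate
  -- product `∞ * 0 = 0`.
  have hfin : EW Γ W ≠ ⊤ := ((iInf₂_le μ₀ hμ₀).trans_lt ENNReal.coe_lt_top).ne
  have h1 : ∀ ν, Admissible Γ' W ν → c / area ν ≤ EW Γ W := by
    intro ν hν
    refine le_iInf₂ fun μ hμ => ENNReal.div_le_of_le_mul (h μ ν hμ hν)
  have h2 : c / EW Γ W ≤ EW Γ' W := by
    refine le_iInf₂ fun ν hν => ENNReal.div_le_of_le_mul ?_
    rw [mul_comm]
    exact (ENNReal.div_le_iff_le_mul (.inr hfin) (.inl ENNReal.coe_ne_top)).1 (h1 ν hν)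
  rw [mul_comm]
  refine (ENNReal.div_le_iff_le_mul (.inl ?_) (.inl hfin)).1 h2
  intro h0
  have := (h1 ν₀ hν₀).trans h0.le
  rw [nonpos_iff_eq_zero, ENNReal.div_eq_zero_iff] at this
  exact this.elim hc0 ENNReal.coe_ne_top

end VertexWidth

/-! ### Boundary quadrilaterals, cuts and the triangulated case. -/

namespace PolygonalSubdivision

open scoped Classical
open SimpleGraph RotationSystem Equiv.Perm VertexWidth

variable {V : Type*} [Fintype V] {G : SimpleGraph V} (R : PolygonalSubdivision G)

/-- Four consecutive pieces `X`, `X'`, `Y`, `Y'` of the boundary, up to cyclic order, with the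
property that paths from `X` to `Y` cross paths from `X'` to `Y'` in the interior. -/
structure IsQuad (X X' Y Y' : Set V) : Prop where
  left : X ⊆ R.boundary.verts
  left' : X' ⊆ R.boundary.verts
  right : Y ⊆ R.boundary.verts
  right' : Y' ⊆ R.boundary.verts
  disj : Disjoint X X'
  disj_left_right : Disjoint X Y
  disj_left_right' : Disjoint X' Y'
  cover : R.boundary.verts ⊆ X ∪ X' ∪ Y ∪ Y'
  corner : ∃! d, R.faceOf d = R.outer ∧ (d.fst ∈ X ∧ d.snd ∈ X' ∨ d.fst ∈ X' ∧ d.snd ∈ X)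
  cross : ∀ {x y x' y' : V}, x ∈ X → y ∈ Y → x' ∈ X' → y' ∈ Y' →
    ∀ (p : R.cone.Walk (.inl x) (.inl y)) (q : R.cone.Walk (.inl x') (.inl y')),
    (∀ z ∈ p.support, z = .inl x ∨ z = .inl y ∨ z ∈ R.withCells R.boundary.vertsᶜ) →
    (∀ z ∈ q.support, z = .inl x' ∨ z = .inl y' ∨ z ∈ R.withCells R.boundary.vertsᶜ) →
    ∃ z ∈ p.support, z ∈ q.support ∧ z ∈ R.withCells R.boundary.vertsᶜ

/-- Every path from `X` to `Y` through interior vertices has length at least `1`, and the metric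
vanishes on the boundary. -/
structure IsAdmissible (X Y : Set V) (μ : V → ℝ≥0) : Prop where
  one_le : ∀ x ∈ X, ∀ y ∈ Y, ∀ p : G.Walk x y,
    (∀ u ∈ p.support, u = x ∨ u = y ∨ u ∈ R.boundary.vertsᶜ) → 1 ≤ (p.support.map μ).sum
  eq_zero : ∀ v ∈ R.boundary.verts, μ v = 0

variable {R} {X X' Y Y' : Set V}

/-- The quasi-duality argument runs in both directions, with the two families exchanged. -/
theorem IsQuad.symm (Q : R.IsQuad X X' Y Y') : R.IsQuad X' X Y' Y where
  left := Q.left'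
  left' := Q.left
  right := Q.right'
  right' := Q.right
  disj := Q.disj.symm
  disj_left_right := Q.disj_left_right'
  disj_left_right' := Q.disj_left_right
  cover v hv := by
    rcases Q.cover hv with ((h | h) | h) | h
    exacts [.inl (.inl (.inr h)), .inl (.inl (.inl h)), .inr h, .inl (.inr h)]
  corner := by simpa only [or_comm] using Q.corner
  cross hx' hy' hx hy p q hp hq := by
    obtain ⟨z, h1, h2, h3⟩ := Q.cross hx hy hx' hy' q p hq hp
    exact ⟨z, h2, h1, h3⟩

theorem isQuad_arcVerts {x y : G.Dart} (hx : R.faceOf x = R.outer) (hy : R.faceOf y = R.outer)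
    (hxy : x ≠ y) (hadj : ¬ R.boundary.Adj x.fst y.fst) :
    R.IsQuad {x.fst} (R.arcVerts x y) {y.fst} (R.arcVerts y x) where
  left := Set.singleton_subset_iff.2 (R.fst_mem_boundary hx)
  left' := arcVerts_subset hx
  right := Set.singleton_subset_iff.2 (R.fst_mem_boundary hy)
  right' := arcVerts_subset hy
  disj := Set.disjoint_singleton_left.2 (left_notMem_arcVerts hx)
  disj_left_right := by
    rw [Set.disjoint_singleton]
    exact fst_ne_of_ne hx hy hxy
  disj_left_right' := disjoint_arcVerts hx hy
  cover := boundary_subset hy hxy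
  corner := existsUnique_dart_arcVerts hx hy hxy hadj
  cross := by
    rintro _ _ _ _ rfl rfl ⟨du, hu, hux, rfl⟩ ⟨dv, hv, hvy, rfl⟩ p q hp hq
    have huo := faceOf_of_arc hx hu
    have hvo := faceOf_of_arc hy hv
    obtain ⟨z, hzp, hzq⟩ := R.exists_mem_support_inter hx hy hxy huo hvo
      (fun h => hv.not_arc_symm (h.1 hu)) p (fun h => by simpa using hp _ h) q
      (fun h => by simpa using hq _ h)
    refine ⟨z, hzp, hzq, ?_⟩
    have hne : ∀ d d' : G.Dart, R.faceOf d = R.outer → R.faceOf d' = R.outer → d' ≠ d →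
        (Sum.inl d.fst : V ⊕ R.Face) ≠ .inl d'.fst := fun d d' hd hd' h h' =>
      fst_ne_of_ne hd hd' h.symm (Sum.inl_injective h')
    rcases hp z hzp with rfl | rfl | h
    · exact ((hq _ hzq).resolve_left (hne _ _ hx huo hux)).resolve_left
        (hne _ _ hx hvo hv.ne_right)
    · exact ((hq _ hzq).resolve_left (hne _ _ hy huo hu.ne_right)).resolve_left
        (hne _ _ hy hvo hvy)
    · exact h

/-- It suffices that `Γ` contains the simple paths: erasing loops from a walk does not increase its
length. -/
theorem isAdmissible_of_admissible {Γ : Set (GraphPath G)}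
    (hΓ : ∀ x ∈ X, ∀ y ∈ Y, ∀ p : G.Walk x y, p.IsPath →
      (∀ u ∈ p.support, u = x ∨ u = y ∨ u ∉ R.boundary.verts) → (⟨x, y, p⟩ : GraphPath G) ∈ Γ)
    {μ : V → ℝ≥0} (hμ : Admissible Γ R.boundary.verts μ) : R.IsAdmissible X Y μ where
  one_le x hx y hy p hp :=
    (hμ.1 _ (hΓ x hx y hy p.bypass p.bypass_isPath fun u hu =>
      hp u (p.support_bypass_subset_support hu))).trans
      ((p.support_bypass_sublist_support.map μ).sum_le_sum fun _ _ => zero_le)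
  eq_zero := hμ.2

variable (R) in
/-- A walk in `G`, as a walk in the coned graph. -/
def coneWalk {x y : V} (p : G.Walk x y) : R.cone.Walk (.inl x) (.inl y) := p.map R.toCone

theorem mem_support_coneWalk {x y : V} {p : G.Walk x y} {z : V ⊕ R.Face} :
    z ∈ (R.coneWalk p).support ↔ ∃ u ∈ p.support, .inl u = z := by
  unfold coneWalk
  erw [Walk.support_map]
  exact List.mem_map

theorem mem_withCells_coneWalk {S : Set V} {x y : V} (p : G.Walk x y)
    (hp : ∀ u ∈ p.support, u = x ∨ u = y ∨ u ∈ S) :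
    ∀ z ∈ (R.coneWalk p).support, z = .inl x ∨ z = .inl y ∨ z ∈ R.withCells S := by
  intro z hz
  obtain ⟨u, hu, rfl⟩ := mem_support_coneWalk.1 hz
  rcases hp u hu with rfl | rfl | h
  exacts [.inl rfl, .inr (.inl rfl), .inr (.inr h)]

/-- Paths in `G` from `X` to `Y` and from `X'` to `Y'` meet at an interior vertex. -/
theorem IsQuad.exists_mem_support (Q : R.IsQuad X X' Y Y') {x y x' y' : V} (hx : x ∈ X)
    (hy : y ∈ Y) (hx' : x' ∈ X') (hy' : y' ∈ Y') (p : G.Walk x y) (q : G.Walk x' y')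
    (hp : ∀ u ∈ p.support, u = x ∨ u = y ∨ u ∈ R.boundary.vertsᶜ)
    (hq : ∀ u ∈ q.support, u = x' ∨ u = y' ∨ u ∈ R.boundary.vertsᶜ) :
    ∃ z ∈ p.support, z ∈ q.support ∧ z ∉ R.boundary.verts := by
  obtain ⟨z, h1, h2, h3⟩ := Q.cross hx hy hx' hy' (R.coneWalk p) (R.coneWalk q)
    (mem_withCells_coneWalk p hp) (mem_withCells_coneWalk q hq)
  obtain ⟨u, hu, rfl⟩ := mem_support_coneWalk.1 h1
  obtain ⟨v, hv, hvu⟩ := mem_support_coneWalk.1 h2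
  obtain rfl : v = u := Sum.inl_injective hvu
  exact ⟨v, hu, hv, h3⟩

/-- If `X` and `Y` are connected by a path, then no `2`-cell touches both `X'` and `Y'`. -/
theorem IsQuad.notMem_faceVerts (Q : R.IsQuad X X' Y Y') {x y x' y' : V} (hx : x ∈ X)
    (hy : y ∈ Y) (hx' : x' ∈ X') (hy' : y' ∈ Y') (p : G.Walk x y)
    (hp : ∀ u ∈ p.support, u = x ∨ u = y ∨ u ∈ R.boundary.vertsᶜ) {F : R.Face}
    (hF : F ≠ R.outer) (h : x' ∈ R.faceVerts F) : y' ∉ R.faceVerts F := by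
  intro h'
  obtain ⟨z, h1, h2, h3⟩ := Q.cross hx hy hx' hy' (R.coneWalk p)
    (.cons (R.cone_adj_inl_inr.2 h) (.cons (R.cone_adj_inr_inl.2 h') .nil))
    (mem_withCells_coneWalk p hp) (by simp [hF])
  simp only [Walk.support_cons, Walk.support_nil, List.mem_cons, List.not_mem_nil, or_false]
    at h2
  rcases h2 with rfl | rfl | rfl
  · exact h3 (Q.left' hx')
  · obtain ⟨u, -, hu⟩ := mem_support_coneWalk.1 h1
    cases hu
  · exact h3 (Q.right' hy')

/-- A separating set of interior vertices, together with the `2`-cells, contains a path between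
the two other sides. The relation `r` tells which of its vertices accompanies a `2`-cell on the
path. -/
theorem IsQuad.exists_path_of_cut (Q : R.IsQuad X X' Y Y') {x y : V} (hx : x ∈ X) (hy : y ∈ Y)
    (p : G.Walk x y) (hp : ∀ u ∈ p.support, u = x ∨ u = y ∨ u ∈ R.boundary.vertsᶜ)
    {A : Finset V} (hA : (A : Set V) ⊆ R.boundary.vertsᶜ)
    (hcut : ∀ u y, G.ReachThrough (R.boundary.vertsᶜ \ A) X u → y ∈ Y → ¬ G.Adj u y) :
    ∃ x' ∈ X', ∃ y' ∈ Y', ∃ q : R.cone.Walk (.inl x') (.inl y'), ∃ r : V → R.Face → Prop,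
      (∀ z ∈ q.support, z = .inl x' ∨ z = .inl y' ∨ z ∈ R.withCells (A : Set V)) ∧
      (∀ F, .inr F ∈ q.support → ∃ w, r w F) ∧
      (∀ w F, r w F → w ∈ A ∧ w ∈ R.faceVerts F) ∧
      ∀ w, {F | r w F}.ncard ≤ 2 := by
  obtain ⟨z, y', hy', hz, hzy⟩ := R.exists_reachThrough_withCells
    (Set.disjoint_left.2 fun v hv hv' => hA hv hv') Q.left Q.left' Q.disj Q.cover Q.corner hcut
  obtain ⟨_, ⟨x', hx', rfl⟩, q₀, hq₀⟩ := hz.exists_walk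
  have hq₁ : ∀ z ∈ (q₀.concat hzy).bypass.support,
      z = .inl x' ∨ z = .inl y' ∨ z ∈ R.withCells (A : Set V) := by
    intro z hz
    have := (q₀.concat hzy).support_bypass_subset_support hz
    rw [Walk.support_concat, List.mem_append, List.mem_singleton] at this
    rcases this with h | h
    · exact (hq₀ z h).imp_right .inr
    · exact .inr (.inl h)
  have hq : (q₀.concat hzy).bypass.IsPath := Walk.bypass_isPath _
  generalize (q₀.concat hzy).bypass = q at hq hq₁
  have hb : ∀ v ∈ A, v ∉ R.boundary.verts := fun v hv => hA hv
  refine ⟨x', hx', y', hy', q, fun w F => w ∈ A ∧ q.toSubgraph.Adj (.inl w) (.inr F), hq₁,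
    fun F hF => ?_, fun w F h => ⟨h.1, h.2.adj_sub⟩, fun w => ?_⟩
  -- A cell on `q` has two distinct neighbours on `q`, both vertices of `G`. They cannot be `x'` and
  -- `y'`, since no cell touches both `X'` and `Y'`; so one of them lies in `A`.
  · have hFo : F ≠ R.outer := by simpa using hq₁ _ hF
    obtain ⟨i, hi, hil⟩ := q.mem_support_iff_exists_getVert.1 hF
    have h0 : i ≠ 0 := by
      rintro rfl
      simp at hi
    have h1 : i ≠ q.length := by
      rintro rfl
      simp at hi
    have hl : i < q.length := lt_of_le_of_ne hil h1
    have hnb := hq.neighborSet_toSubgraph_internal h0 hl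
    rw [hi] at hnb
    have ha1 : q.toSubgraph.Adj (.inr F) (q.getVert (i - 1)) := by
      rw [← Subgraph.mem_neighborSet, hnb]
      simp
    have ha2 : q.toSubgraph.Adj (.inr F) (q.getVert (i + 1)) := by
      rw [← Subgraph.mem_neighborSet, hnb]
      simp
    have hne : q.getVert (i - 1) ≠ q.getVert (i + 1) := fun h => by
      have := hq.getVert_injOn (show i - 1 ≤ q.length by omega) (show i + 1 ≤ q.length by omega) h
      omega
    have hs1 := hq₁ _ (q.getVert_mem_support (i - 1))
    have hs2 := hq₁ _ (q.getVert_mem_support (i + 1))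
    generalize q.getVert (i - 1) = z₁ at *
    generalize q.getVert (i + 1) = z₂ at *
    rcases z₁ with w₁ | F₁
    swap
    · exact (R.cone_adj_inr_inr ha1.adj_sub).elim
    rcases z₂ with w₂ | F₂
    swap
    · exact (R.cone_adj_inr_inr ha2.adj_sub).elim
    rcases hs1 with h | h | h
    · obtain rfl := Sum.inl_injective h
      rcases hs2 with h | h | h
      · exact (hne h.symm).elim
      · obtain rfl := Sum.inl_injective h
        exact (Q.notMem_faceVerts hx hy hx' hy' p hp hFo ha1.adj_sub ha2.adj_sub).elim
      · exact ⟨w₂, h, ha2.symm⟩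
    · obtain rfl := Sum.inl_injective h
      rcases hs2 with h | h | h
      · obtain rfl := Sum.inl_injective h
        exact (Q.notMem_faceVerts hx hy hx' hy' p hp hFo ha2.adj_sub ha1.adj_sub).elim
      · exact (hne h.symm).elim
      · exact ⟨w₂, h, ha2.symm⟩
    · exact ⟨w₁, h, ha1.symm⟩
  -- A vertex of `A` is not an end of the simple path `q`, hence has exactly two neighbours if it is
  -- on `q`.
  · by_cases hw : w ∈ A ∧ .inl w ∈ q.support
    · obtain ⟨i, hi, hil⟩ := q.mem_support_iff_exists_getVert.1 hw.2
      have h0 : i ≠ 0 := by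
        rintro rfl
        rw [q.getVert_zero] at hi
        exact hb w hw.1 (Sum.inl_injective hi ▸ Q.left' hx')
      have h1 : i ≠ q.length := by
        rintro rfl
        rw [q.getVert_length] at hi
        exact hb w hw.1 (Sum.inl_injective hi ▸ Q.right' hy')
      rw [← hq.ncard_neighborSet_toSubgraph_internal_eq_two h0 (lt_of_le_of_ne hil h1), hi]
      exact Set.ncard_le_ncard_of_injOn .inr (fun F hF => hF.2) Sum.inr_injective.injOn
    · have : {F : R.Face | w ∈ A ∧ q.toSubgraph.Adj (.inl w) (.inr F)} = ∅ :=
        Set.eq_empty_of_forall_notMem fun F h =>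
          hw ⟨h.1, (q.mem_verts_toSubgraph).1 (q.toSubgraph.edge_vert h.2)⟩
      rw [this, Set.ncard_empty]
      exact Nat.zero_le _

theorem IsAdmissible.exists_weights (Q : R.IsQuad X X' Y Y') {μ : V → ℝ≥0}
    (hμ : R.IsAdmissible X Y μ) :
    ∃ p : Finset V → ℝ, (∀ A, 0 ≤ p A) ∧ ∑ A, p A = 1 ∧
      (∀ A, p A ≠ 0 → (A : Set V) ⊆ R.boundary.vertsᶜ ∧
        ∀ u y, G.ReachThrough (R.boundary.vertsᶜ \ A) X u → y ∈ Y → ¬ G.Adj u y) ∧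
      ∀ v, ∑ A, (if v ∈ A then p A else 0) ≤ μ v :=
  exists_weights_of_admissible (fun x hx => hμ.eq_zero x (Q.left hx))
    (fun y hy => hμ.eq_zero y (Q.right hy)) hμ.one_le

/-- Length–area inequality in a triangulation. -/
theorem IsQuad.one_le_area_mul_area_of_triangulation (Q : R.IsQuad X X' Y Y')
    (h3 : ∀ F, F ≠ R.outer → (R.faceVerts F).ncard ≤ 3) {μ ν : V → ℝ≥0}
    (hμ : R.IsAdmissible X Y μ) (hν : R.IsAdmissible X' Y' ν) : 1 ≤ area μ * area ν := by
  obtain ⟨p, hp0, hp1, hpA, hpμ⟩ := hμ.exists_weights Q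
  -- Every cut contains all the interior vertices of some path from `X'` to `Y'`, and `ν` vanishes
  -- at the ends of that path.
  have key : ∀ A, p A ≠ 0 → 1 ≤ ∑ v ∈ A, (ν v : ℝ) := by
    intro A hA
    obtain ⟨hAb, hcut⟩ := hpA A hA
    obtain ⟨z, y', hy', hz, hzy⟩ := R.exists_reachThrough_withCells
      (Set.disjoint_left.2 fun v hv hv' => hAb hv hv') Q.left Q.left' Q.disj Q.cover Q.corner hcut
    obtain ⟨v, hv, hvy⟩ : ∃ v, G.ReachThrough (A : Set V) X' v ∧ G.Adj v y' := by
      have h := ReachThrough.of_withCells R h3 hz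
      rcases z with v | F
      · exact ⟨v, h, hzy⟩
      · obtain ⟨v, hvF, hv⟩ := h
        refine ⟨v, hv, R.adj_of_mem_faceVerts (h3 F ?_) hvF hzy ?_⟩
        · simpa using hz.mem
        · rintro rfl
          rcases hv.mem with h | h
          · exact Set.disjoint_left.1 Q.disj_left_right' h hy'
          · exact hAb h (Q.right' hy')
    obtain ⟨x', hx', q, hq⟩ := hv.exists_walk
    have hq' : ∀ u ∈ (q.concat hvy).bypass.support, u = x' ∨ u = y' ∨ u ∈ A := by
      intro u hu
      have := (q.concat hvy).support_bypass_subset_support hu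
      rw [Walk.support_concat, List.mem_append, List.mem_singleton] at this
      rcases this with h | h
      · exact (hq u h).imp_right .inr
      · exact .inr (.inl h)
    have h1 := hν.one_le x' hx' y' hy' (q.concat hvy).bypass fun u hu =>
      (hq' u hu).imp_right (.imp_right fun h => hAb h)
    rw [← List.sum_toFinset _ (Walk.bypass_isPath _).support_nodup] at h1
    have h2 : ∑ v ∈ (q.concat hvy).bypass.support.toFinset, ν v ≤ ∑ v ∈ A, ν v := by
      refine Finset.sum_le_sum_of_ne_zero fun u hu hu0 => ?_
      rcases hq' u (List.mem_toFinset.1 hu) with rfl | rfl | h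
      · exact (hu0 (hν.eq_zero _ (Q.left' hx'))).elim
      · exact (hu0 (hν.eq_zero _ (Q.right' hy'))).elim
      · exact h
    exact_mod_cast h1.trans h2
  have h1 : (1 : ℝ) ≤ ∑ v, (μ v : ℝ) * ν v := by
    calc (1 : ℝ) = ∑ A, p A := hp1.symm
      _ ≤ ∑ A, p A * ∑ v ∈ A, (ν v : ℝ) := Finset.sum_le_sum fun A _ => by
          by_cases hA : p A = 0
          · simp [hA]
          · exact le_mul_of_one_le_right (hp0 A) (key A hA)
      _ = ∑ v, (∑ A, if v ∈ A then p A else 0) * (ν v : ℝ) := by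
          simp_rw [Finset.mul_sum, Finset.sum_mul, ite_mul, zero_mul]
          rw [Finset.sum_comm]
          refine Finset.sum_congr rfl fun A _ => ?_
          rw [← Finset.sum_filter]
          simp
      _ ≤ _ := Finset.sum_le_sum fun v _ => mul_le_mul_of_nonneg_right (hpμ v) (ν v).2
  have h2 := Finset.sum_mul_sq_le_sq_mul_sq Finset.univ (fun v => (μ v : ℝ)) fun v => (ν v : ℝ)
  rw [← NNReal.coe_le_coe]
  simp only [area, NNReal.coe_mul, NNReal.coe_sum, NNReal.coe_pow, NNReal.coe_one]
  nlinarith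

end PolygonalSubdivision

/-! ### Random paths through vertices and cells. -/

namespace VertexWidth

open scoped Classical

/-- Suppose that a convex combination of sets `P i` of vertices and cells is such that each cell
of `P i` is accompanied by one of its at most `N` vertices, lying in `A i`, and each vertex
accompanies at most two cells. Then the combination is controlled by that of the sets `A i`. -/
theorem sum_weight_sq_le {ι α β : Type*} [Fintype ι] [Fintype α] [Fintype β] {p : ι → ℝ}
    (hp : ∀ i, 0 ≤ p i) (A : ι → Finset α) (P : ι → Set (α ⊕ β)) (r : ι → α → β → Prop)
    (B : β → Set α) (N : ℕ) (hα : ∀ i v, .inl v ∈ P i → v ∈ A i)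
    (hβ : ∀ i F, .inr F ∈ P i → ∃ w, r i w F) (hr : ∀ i w F, r i w F → w ∈ A i ∧ w ∈ B F)
    (hN : ∀ i w F, r i w F → (B F).ncard ≤ N) (hr2 : ∀ i w, {F | r i w F}.ncard ≤ 2)
    {μ : α → ℝ} (hμ : ∀ v, ∑ i, (if v ∈ A i then p i else 0) ≤ μ v) :
    ∑ z, (∑ i, if z ∈ P i then p i else 0) ^ 2 ≤ (4 * N + 1) * ∑ v, μ v ^ 2 := by
  have hA0 : ∀ v, 0 ≤ ∑ i, (if v ∈ A i then p i else 0) := fun v =>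
    Finset.sum_nonneg fun i _ => by split_ifs <;> simp [hp i]
  let f : α → β → ℝ := fun w F => ∑ i, if r i w F then p i else 0
  have hf0 : ∀ w F, 0 ≤ f w F := fun w F => Finset.sum_nonneg fun i _ => by
    split_ifs <;> simp [hp i]
  have hvert : ∀ v, (∑ i, if (.inl v : α ⊕ β) ∈ P i then p i else 0) ^ 2 ≤ μ v ^ 2 := by
    intro v
    refine pow_le_pow_left₀ (Finset.sum_nonneg fun i _ => by split_ifs <;> simp [hp i])
      (le_trans (Finset.sum_le_sum fun i _ => ?_) (hμ v)) 2
    split_ifs with h1 h2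
    · exact le_rfl
    · exact (h2 (hα i v h1)).elim
    · exact hp i
    · exact le_rfl
  -- The weight of `F` is at most the sum of the weights `f w F` charged to its vertices;
  -- Cauchy–Schwarz over at most `N` of them gives the factor `N`.
  have hcell : ∀ F, (∑ i, if (.inr F : α ⊕ β) ∈ P i then p i else 0) ^ 2 ≤
      N * ∑ w, f w F ^ 2 := by
    intro F
    by_cases hF : ∃ i w, r i w F
    · obtain ⟨i, w, h⟩ := hF
      have hcard : ((B F).toFinset.card : ℝ) ≤ N := by
        rw [← Set.ncard_eq_toFinset_card']
        exact_mod_cast hN i w F h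
      have h1 : (∑ i, if (.inr F : α ⊕ β) ∈ P i then p i else 0) ≤ ∑ w ∈ (B F).toFinset, f w F := by
        rw [Finset.sum_comm]
        refine Finset.sum_le_sum fun i _ => ?_
        have h0 : ∀ w ∈ (B F).toFinset, 0 ≤ if r i w F then p i else 0 := fun w _ => by
          split_ifs <;> simp [hp i]
        split_ifs with hi
        · obtain ⟨w, hw⟩ := hβ i F hi
          refine le_trans ?_ (Finset.single_le_sum h0 (Set.mem_toFinset.2 (hr i w F hw).2))
          rw [if_pos hw]
        · exact Finset.sum_nonneg h0
      calc _ ≤ (∑ w ∈ (B F).toFinset, f w F) ^ 2 := pow_le_pow_left₀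
            (Finset.sum_nonneg fun i _ => by split_ifs <;> simp [hp i]) h1 2
        _ ≤ (B F).toFinset.card * ∑ w ∈ (B F).toFinset, f w F ^ 2 := sq_sum_le_card_mul_sum_sq
        _ ≤ N * ∑ w, f w F ^ 2 := by
          refine mul_le_mul hcard (Finset.sum_le_univ_sum_of_nonneg fun w => sq_nonneg _)
            (Finset.sum_nonneg fun w _ => sq_nonneg _) N.cast_nonneg
    · push Not at hF
      have : (∑ i, if (.inr F : α ⊕ β) ∈ P i then p i else 0) = 0 :=
        Finset.sum_eq_zero fun i _ => if_neg fun h => by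
          obtain ⟨w, hw⟩ := hβ i F h
          exact hF i w hw
      rw [this]
      rw [zero_pow two_ne_zero]
      exact mul_nonneg N.cast_nonneg (Finset.sum_nonneg fun w _ => sq_nonneg _)
  -- For each index `w` accompanies at most two cells, so its total charge is at most `2 μ w`; this
  -- is the source of the `4`. The vertices of the paths contribute the remaining `1` in `4 N + 1`.
  have hsum : ∀ w, ∑ F, f w F ^ 2 ≤ 4 * μ w ^ 2 := by
    intro w
    have h1 : ∑ F, f w F ≤ 2 * μ w := by
      rw [Finset.sum_comm]
      refine le_trans ?_ (mul_le_mul_of_nonneg_left (hμ w) zero_le_two)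
      rw [Finset.mul_sum]
      refine Finset.sum_le_sum fun i _ => ?_
      rw [← Finset.sum_filter, Finset.sum_const, nsmul_eq_mul]
      have h2 : ((Finset.univ.filter (r i w)).card : ℝ) ≤ 2 := by
        rw [← Set.ncard_coe_finset, Finset.coe_filter]
        simpa using hr2 i w
      split_ifs with hw
      · exact mul_le_mul_of_nonneg_right h2 (hp i)
      · rw [Finset.filter_eq_empty_iff.2 fun F _ h => hw (hr i w F h).1]
        simp
    calc ∑ F, f w F ^ 2 ≤ (∑ F, f w F) ^ 2 :=
          Finset.sum_sq_le_sq_sum_of_nonneg fun F _ => hf0 w F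
      _ ≤ (2 * μ w) ^ 2 := pow_le_pow_left₀ (Finset.sum_nonneg fun F _ => hf0 w F) h1 2
      _ = 4 * μ w ^ 2 := by ring
  rw [Fintype.sum_sum_type]
  have h1 := Finset.sum_le_sum fun v (_ : v ∈ Finset.univ) => hvert v
  have h2 : ∑ F, (∑ i, if (.inr F : α ⊕ β) ∈ P i then p i else 0) ^ 2 ≤
      4 * N * ∑ v, μ v ^ 2 := by
    calc _ ≤ ∑ F, N * ∑ w, f w F ^ 2 := Finset.sum_le_sum fun F _ => hcell F
      _ = N * ∑ w, ∑ F, f w F ^ 2 := by rw [← Finset.mul_sum, Finset.sum_comm]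
      _ ≤ N * ∑ w, 4 * μ w ^ 2 :=
        mul_le_mul_of_nonneg_left (Finset.sum_le_sum fun w _ => hsum w) N.cast_nonneg
      _ = _ := by rw [← Finset.mul_sum]; ring
  linarith

/-- Two convex combinations of sets any two of which meet have inner product at least `1`. -/
theorem one_le_sum_mul_sum {ι κ γ : Type*} [Fintype ι] [Fintype κ] [Fintype γ] {p : ι → ℝ}
    {q : κ → ℝ} (hp : ∀ i, 0 ≤ p i) (hq : ∀ j, 0 ≤ q j) (hp1 : ∑ i, p i = 1)
    (hq1 : ∑ j, q j = 1) (P : ι → Set γ) (Q : κ → Set γ)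
    (h : ∀ i j, p i ≠ 0 → q j ≠ 0 → (P i ∩ Q j).Nonempty) :
    1 ≤ ∑ z, (∑ i, if z ∈ P i then p i else 0) * ∑ j, if z ∈ Q j then q j else 0 := by
  calc (1 : ℝ) = ∑ i, ∑ j, p i * q j := by rw [← Finset.sum_mul_sum, hp1, hq1, one_mul]
    _ ≤ ∑ i, ∑ j, ∑ z, (if z ∈ P i then p i else 0) * (if z ∈ Q j then q j else 0) := by
      refine Finset.sum_le_sum fun i _ => Finset.sum_le_sum fun j _ => ?_
      have h0 : ∀ z ∈ Finset.univ,
          0 ≤ (if z ∈ P i then p i else 0) * (if z ∈ Q j then q j else 0) := fun z _ => by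
        have := hp i
        have := hq j
        split_ifs <;> positivity
      by_cases hi : p i = 0
      · simp [hi]
      by_cases hj : q j = 0
      · simp [hj]
      obtain ⟨z, hz1, hz2⟩ := h i j hi hj
      refine le_trans ?_ (Finset.single_le_sum h0 (Finset.mem_univ z))
      rw [if_pos hz1, if_pos hz2]
    _ = _ := by
      simp_rw [Finset.sum_mul_sum]
      rw [Finset.sum_comm' (t' := Finset.univ) (s' := fun _ => Finset.univ) (by simp)]
      rw [Finset.sum_comm (s := (Finset.univ : Finset γ))]
      rw [Finset.sum_comm]
      refine Finset.sum_congr rfl fun i _ => ?_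
      rw [Finset.sum_comm]

end VertexWidth

/-! ### The length–area inequality in a polygonal subdivision. -/

namespace PolygonalSubdivision

open scoped Classical
open SimpleGraph RotationSystem Equiv.Perm VertexWidth

variable {V : Type*} [Fintype V] {G : SimpleGraph V} {R : PolygonalSubdivision G}
  {X X' Y Y' : Set V}

theorem ncard_faceVerts_le {F : R.Face} (hF : F ≠ R.outer) :
    (R.faceVerts F).ncard ≤ R.complexity :=
  le_ciSup (f := fun F : {F : R.Face // F ≠ R.outer} => (R.faceVerts F).ncard)
    (Set.finite_range _).bddAbove ⟨F, hF⟩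

/-- From an admissible metric for the paths from `X` to `Y` we obtain a convex combination of
paths from `X'` to `Y'` in the coned graph, whose area is controlled. -/
theorem IsQuad.exists_flow (Q : R.IsQuad X X' Y Y') {x y : V} (hx : x ∈ X) (hy : y ∈ Y)
    (γ : G.Walk x y) (hγ : ∀ u ∈ γ.support, u = x ∨ u = y ∨ u ∈ R.boundary.vertsᶜ)
    {μ : V → ℝ≥0} (hμ : R.IsAdmissible X Y μ) :
    ∃ (p : Finset V → ℝ) (P : Finset V → Set (V ⊕ R.Face)),
      (∀ A, 0 ≤ p A) ∧ ∑ A, p A = 1 ∧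
      (∀ A, p A ≠ 0 → ∃ x' ∈ X', ∃ y' ∈ Y', ∃ q : R.cone.Walk (.inl x') (.inl y'),
        (∀ z ∈ q.support, z = .inl x' ∨ z = .inl y' ∨ z ∈ R.withCells R.boundary.vertsᶜ) ∧
        P A = {z | z ∈ q.support ∧ z ∈ R.withCells R.boundary.vertsᶜ}) ∧
      ∑ z, (∑ A, if z ∈ P A then p A else 0) ^ 2 ≤ (4 * R.complexity + 1) * (area μ : ℝ) := by
  obtain ⟨p, hp0, hp1, hpA, hpμ⟩ := hμ.exists_weights Q
  have hex : ∀ A : Finset V, ∃ (P : Set (V ⊕ R.Face)) (r : V → R.Face → Prop),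
      (p A ≠ 0 → ∃ x' ∈ X', ∃ y' ∈ Y', ∃ q : R.cone.Walk (.inl x') (.inl y'),
        (∀ z ∈ q.support, z = .inl x' ∨ z = .inl y' ∨ z ∈ R.withCells R.boundary.vertsᶜ) ∧
        P = {z | z ∈ q.support ∧ z ∈ R.withCells R.boundary.vertsᶜ}) ∧
      (∀ v, .inl v ∈ P → v ∈ A) ∧ (∀ F, .inr F ∈ P → ∃ w, r w F) ∧
      (∀ w F, r w F → w ∈ A ∧ w ∈ R.faceVerts F) ∧
      (∀ w F, r w F → (R.faceVerts F).ncard ≤ R.complexity) ∧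
      ∀ w, {F | r w F}.ncard ≤ 2 := by
    intro A
    by_cases hA : p A = 0
    · exact ⟨∅, fun _ _ => False, by simp [hA]⟩
    · obtain ⟨hAb, hcut⟩ := hpA A hA
      obtain ⟨x', hx', y', hy', q, r, hq, h1, h2, h3⟩ := Q.exists_path_of_cut hx hy γ hγ hAb hcut
      -- The outer face is excluded because the complexity bounds only the other faces.
      refine ⟨_, fun w F => r w F ∧ F ≠ R.outer, fun _ => ⟨x', hx', y', hy', q, fun z hz => ?_,
        rfl⟩, fun v hv => ?_, fun F hF => ?_, fun w F h => h2 w F h.1,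
        fun w F h => ncard_faceVerts_le h.2, fun w => ?_⟩
      · refine (hq z hz).imp_right (.imp_right fun h => ?_)
        rcases z with v | F
        · exact hAb h
        · exact h
      · rcases hq _ hv.1 with h | h | h
        · exact (hv.2 (Sum.inl_injective h ▸ Q.left' hx')).elim
        · exact (hv.2 (Sum.inl_injective h ▸ Q.right' hy')).elim
        · exact h
      · obtain ⟨w, hw⟩ := h1 F hF.1
        exact ⟨w, hw, hF.2⟩
      · exact (Set.ncard_le_ncard fun F h => h.1).trans (h3 w)
  choose P r hP h1 h2 h3 h4 h5 using hex
  refine ⟨p, P, hp0, hp1, hP, ?_⟩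
  have := sum_weight_sq_le hp0 id P r R.faceVerts R.complexity h1 h2 h3 h4 h5
    (μ := fun v => (μ v : ℝ)) hpμ
  simpa only [area, NNReal.coe_sum, NNReal.coe_pow] using this

/-- Length–area inequality in a polygonal subdivision. -/
theorem IsQuad.one_le_mul_area_mul_area (Q : R.IsQuad X X' Y Y') {x y x' y' : V} (hx : x ∈ X)
    (hy : y ∈ Y) (hx' : x' ∈ X') (hy' : y' ∈ Y')
    (γ : G.Walk x y) (hγ : ∀ u ∈ γ.support, u = x ∨ u = y ∨ u ∈ R.boundary.vertsᶜ)
    (γ' : G.Walk x' y') (hγ' : ∀ u ∈ γ'.support, u = x' ∨ u = y' ∨ u ∈ R.boundary.vertsᶜ)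
    {μ ν : V → ℝ≥0} (hμ : R.IsAdmissible X Y μ) (hν : R.IsAdmissible X' Y' ν) :
    1 ≤ (4 * (R.complexity : ℝ≥0) + 1) ^ 2 * (area μ * area ν) := by
  obtain ⟨p, P, hp0, hp1, hP, hpμ⟩ := Q.exists_flow hx hy γ hγ hμ
  obtain ⟨p', P', hp0', hp1', hP', hpν⟩ := Q.symm.exists_flow hx' hy' γ' hγ' hν
  -- The metric `μ` yields paths from `X'` to `Y'` and `ν` yields paths from `X` to `Y`. They cross
  -- in the coned graph, possibly only at a cell, which is why the cells must carry weight.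
  have h1 := one_le_sum_mul_sum hp0 hp0' hp1 hp1' P P' fun A B hA hB => by
    obtain ⟨x₁, hx₁, y₁, hy₁, q, hq, hPA⟩ := hP A hA
    obtain ⟨x₂, hx₂, y₂, hy₂, q', hq', hPB⟩ := hP' B hB
    obtain ⟨z, hz1, hz2, hz3⟩ := Q.cross hx₂ hy₂ hx₁ hy₁ q' q hq' hq
    rw [hPA, hPB]
    exact ⟨z, ⟨hz2, hz3⟩, ⟨hz1, hz3⟩⟩
  have h2 := Finset.sum_mul_sq_le_sq_mul_sq Finset.univ
    (fun z => ∑ A, if z ∈ P A then p A else 0) fun z => ∑ A, if z ∈ P' A then p' A else 0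
  have h3 := mul_le_mul hpμ hpν (Finset.sum_nonneg fun z _ => sq_nonneg _)
    (by positivity)
  rw [← NNReal.coe_le_coe]
  push_cast
  nlinarith

theorem connecting_mem_support {a b : V} {γ : GraphPath G} (hγ : γ ∈ R.connecting a b) :
    γ.1 ∈ ({a} : Set V) ∧ γ.2.1 ∈ ({b} : Set V) ∧
      ∀ u ∈ γ.2.2.support, u = γ.1 ∨ u = γ.2.1 ∨ u ∈ R.boundary.vertsᶜ :=
  ⟨hγ.2.1, hγ.2.2, fun _ hu => hγ.1.mem_support hu⟩

/-- A separating path, or its reversal, leads from one boundary arc to the other. -/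
theorem exists_walk_of_mem_separating {x y : G.Dart} (hx : R.faceOf x = R.outer)
    (hy : R.faceOf y = R.outer) (hxy : x ≠ y) {γ : GraphPath G}
    (hγ : γ ∈ R.separating x.fst y.fst) :
    ∃ u ∈ R.arcVerts x y, ∃ v ∈ R.arcVerts y x, ∃ p : G.Walk u v,
      (∀ w ∈ p.support, w = u ∨ w = v ∨ w ∈ R.boundary.vertsᶜ) ∧
      ∀ w ∈ p.support, w ∈ γ.2.2.support := by
  obtain ⟨s, t, q⟩ := γ
  obtain ⟨hp, hs, ht, hr⟩ := hγ
  have hsupp := fun w hw => hp.mem_support (w := w) hw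
  obtain ⟨⟨d, hd, rfl⟩, hs'⟩ := id hs
  obtain ⟨⟨d', hd', rfl⟩, ht'⟩ := id ht
  have harc := not_arc_iff_of_not_reachable hx hy hxy hd hd' hs ht hr
  have hmem : ∀ d : G.Dart, R.faceOf d = R.outer → d.fst ∉ ({x.fst, y.fst} : Set V) →
      (R.next.Arc x y d → d.fst ∈ R.arcVerts x y) ∧
      (¬ R.next.Arc x y d → d.fst ∈ R.arcVerts y x) := by
    intro d hd hne
    refine ⟨fun h => ⟨d, h, ?_, rfl⟩, fun h => ⟨d, ?_, ?_, rfl⟩⟩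
    · rintro rfl
      exact hne (by simp)
    · exact (arc_or_arc_symm hxy (R.faceOf_eq_iff.1 (hy.trans hd.symm))).resolve_left h
    · rintro rfl
      exact hne (by simp)
  by_cases h1 : R.next.Arc x y d
  · exact ⟨_, (hmem d hd hs').1 h1, _, (hmem d' hd' ht').2 fun h => harc ⟨fun _ => h, fun _ => h1⟩,
      q, hsupp, fun _ => id⟩
  · refine ⟨_, (hmem d' hd' ht').1 ?_, _, (hmem d hd hs').2 h1, q.reverse, fun w hw => ?_,
      fun w hw => ?_⟩
    · by_contra h2
      exact harc ⟨fun h => (h1 h).elim, fun h => (h2 h).elim⟩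
    · rw [Walk.support_reverse, List.mem_reverse] at hw
      rcases hsupp w hw with h | h | h
      exacts [.inr (.inl h), .inl h, .inr (.inr h)]
    · rwa [Walk.support_reverse, List.mem_reverse] at hw

end PolygonalSubdivision

/-! ### Duality and quasi-duality. -/

open PolygonalSubdivision VertexWidth

theorem theorem3p1 {V : Type*} [Fintype V] {G : SimpleGraph V} (R : PolygonalSubdivision G)
    (N : ℕ) (hN : R.complexity = N) (a b : V)
    (ha : a ∈ R.boundary.verts) (hb : b ∈ R.boundary.verts)
    (hab : a ≠ b) (hadj : ¬ R.boundary.Adj a b)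
    (hconn : (R.connecting a b).Nonempty) (hsep : (R.separating a b).Nonempty) :
    (N = 3 →
      VertexWidth.EW (R.connecting a b) R.boundary.verts *
        VertexWidth.EW (R.separating a b) R.boundary.verts = 1) ∧
    (1 / (4 * (N : ENNReal) + 1) ^ 2 ≤
        VertexWidth.EW (R.connecting a b) R.boundary.verts *
          VertexWidth.EW (R.separating a b) R.boundary.verts ∧
      VertexWidth.EW (R.connecting a b) R.boundary.verts *
          VertexWidth.EW (R.separating a b) R.boundary.verts ≤ 1) ∧
    (1 ≤ VertexWidth.EL (R.connecting a b) R.boundary.verts *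
          VertexWidth.EL (R.separating a b) R.boundary.verts ∧
      VertexWidth.EL (R.connecting a b) R.boundary.verts *
          VertexWidth.EL (R.separating a b) R.boundary.verts ≤ (4 * (N : ENNReal) + 1) ^ 2) := by
  obtain ⟨x, hx, rfl⟩ := ha
  obtain ⟨y, hy, rfl⟩ := hb
  have hxy : x ≠ y := fun h => hab (h ▸ rfl)
  have Q := isQuad_arcVerts hx hy hxy hadj
  -- The common vertex has to be interior, because admissible metrics vanish on the boundary.
  have hmeet : ∀ γ ∈ R.connecting x.fst y.fst, ∀ γ' ∈ R.separating x.fst y.fst,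
      ∃ z ∈ γ.2.2.support, z ∈ γ'.2.2.support ∧ z ∉ R.boundary.verts := by
    intro γ hγ γ' hγ'
    obtain ⟨u, hu, v, hv, p, hp, hsub⟩ := exists_walk_of_mem_separating hx hy hxy hγ'
    obtain ⟨h1, h2, h3⟩ := connecting_mem_support hγ
    obtain ⟨z, hz1, hz2, hz3⟩ := Q.exists_mem_support h1 h2 hu hv γ.2.2 p h3 hp
    exact ⟨z, hz1, hsub z hz2, hz3⟩
  have hadm : ∀ μ, Admissible (R.connecting x.fst y.fst) R.boundary.verts μ →
      R.IsAdmissible {x.fst} {y.fst} μ := fun μ hμ => by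
    refine isAdmissible_of_admissible ?_ hμ
    rintro _ rfl _ rfl p hp hs
    exact ⟨isProper_of_isPath (R.fst_mem_boundary hx) (R.fst_mem_boundary hy) hadj p hp hs,
      rfl, rfl⟩
  have hadm' : ∀ ν, Admissible (R.separating x.fst y.fst) R.boundary.verts ν →
      R.IsAdmissible (R.arcVerts x y) (R.arcVerts y x) ν := fun ν hν => by
    refine isAdmissible_of_admissible ?_ hν
    intro u hu v hv p hp hs
    exact ⟨isProper_of_isPath (arcVerts_subset hx hu) (arcVerts_subset hy hv)
      (not_boundary_adj_arcVerts hx hy hu hv) p hp hs,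
      not_reachable_of_arcVerts hx hy hxy hu hv⟩
  have hle := EW_mul_EW_le_one hconn hsep hmeet
  have hK0 : (4 * (N : ℝ≥0∞) + 1) ^ 2 ≠ 0 := by simp
  have hKt : (4 * (N : ℝ≥0∞) + 1) ^ 2 ≠ ⊤ := by finiteness
  have hge : 1 / (4 * (N : ℝ≥0∞) + 1) ^ 2 ≤ EW (R.connecting x.fst y.fst) R.boundary.verts *
      EW (R.separating x.fst y.fst) R.boundary.verts := by
    refine le_EW_mul_EW (ENNReal.div_ne_top ENNReal.one_ne_top hK0) (fun μ ν hμ hν => ?_)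
      hconn hsep hmeet
    obtain ⟨γ, hγ⟩ := id hconn
    obtain ⟨γ', hγ'⟩ := id hsep
    obtain ⟨u, hu, v, hv, p, hp, -⟩ := exists_walk_of_mem_separating hx hy hxy hγ'
    obtain ⟨h1, h2, h3⟩ := connecting_mem_support hγ
    have := Q.one_le_mul_area_mul_area h1 h2 hu hv γ.2.2 h3 p hp (hadm μ hμ) (hadm' ν hν)
    rw [hN, mul_comm] at this
    exact ENNReal.div_le_of_le_mul (by exact_mod_cast this)
  refine ⟨fun hN3 => le_antisymm hle ?_, ⟨hge, hle⟩, ?_⟩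
  · refine le_EW_mul_EW ENNReal.one_ne_top (fun μ ν hμ hν => ?_) hconn hsep hmeet
    have := Q.one_le_area_mul_area_of_triangulation
      (fun F hF => (ncard_faceVerts_le hF).trans (hN.trans hN3).le) (hadm μ hμ) (hadm' ν hν)
    exact_mod_cast this
  · have hne : EW (R.connecting x.fst y.fst) R.boundary.verts *
        EW (R.separating x.fst y.fst) R.boundary.verts ≠ 0 := fun h0 => by
      rw [h0, nonpos_iff_eq_zero, ENNReal.div_eq_zero_iff] at hge
      exact hge.elim one_ne_zero hKt
    obtain ⟨hne1, hne2⟩ := mul_ne_zero_iff.1 hne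
    rw [EL, EL, one_div, one_div, ← ENNReal.mul_inv (.inl hne1) (.inr hne2), ENNReal.one_le_inv]
    exact ⟨hle, ENNReal.inv_le_iff_inv_le.1 ((one_div _).symm.le.trans hge)⟩
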